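/- Let $d\ge 1$ and let $C=[-\tfrac12,\tfrac12]^d$ be the standard cube, with vertices $c_s$, $s\in\{0,1\}^d$ (coordinate $i$ of $c_s$ is $\tfrac12$ if $s_i=1$ and $-\tfrac12$ if $s_i=0$). A *(labelled) realization of the $d$-cube* is a family $V=(v_s)_{s\in\{0,1\}^d}$ of points of $\mathbb R^d$ such that the label sets of the faces of the polytope $\operatorname{conv}(V)$ are exactly the label sets of the faces of $C$; thus $\operatorname{conv}(V)$ is a (bounded) combinatorial $d$-cube with vertices $v_s$. Let $R_d$ be the set of all realizations, topologized by the vertex coordinates. A realization $W$ arises from $V$ by a *projective transformation* if $w_s=\varphi(v_s)$ for all $s$, where $\varphi(x)=\frac{Ax+b}{c^{T}x+\alpha}$ with $\det\begin{pmatrix}A&b\\c^{T}&\alpha\end{pmatrix}\ne0$ and $c^{T}x+\alpha\neq0$ on $\operatorname{conv}(V)$. It arises from $V$ by a *normal transformation* if $\operatorname{conv}(V)$ and $\operatorname{conv}(W)$ have the same set of unit outer facet normals and facets with the same outer normal have the same vertex labels. **Theorem.** (a) For any two realizations $Q,Q'\in R_d$ there are $m\le 8d-1$ and realizations $Q=P_0,P_1,\dots,P_m=Q'$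 in $R_d$ such that each $P_{k+1}$ arises from $P_k$ by a projective or a normal transformation. (b) There is a continuous map $F:R_d\times[0,4d+2]\to R_d$ such that - $F(Q,0)=Q$ and $F(Q,4d+2)$ is congruent to the standard cube (as a labelled realization), for all $Q\in R_d$; - for every integer $0\le k<4d+2$, either for all $Q\in R_d$ and $t\in[k,k+1]$ the cube $F(Q,t)$ arises from $F(Q,k)$ by a projective transformation, or for all such $Q$ and $t$ it arises from $F(Q,k)$ by a normal transformation; - $F(gQ,t)=gF(Q,t)$ for every isometry $g$ of $\mathbb R^d$. Moreover, the realization space of the $d$-cube is contractible, both when taken up to congruence ($R_d$ modulo isometries of $\mathbb R^d$) and when taken up to affine equivalence ($R_d$ modulo affine automorphisms of $\mathbb R^d$), with the quotient topologies. -/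

import Mathlib

noncomputable section

namespace NormalProjective

/-- Euclidean `d`-space. -/
abbrev Space (d : ℕ) : Type := EuclideanSpace ℝ (Fin d)

/-- The vertex labels of the `d`-cube. -/
abbrev Label (d : ℕ) : Type := Fin d → Bool

/-- The vertices of the standard cube: axis-parallel, of edge length `1`, centred at the origin. -/
def stdCube (d : ℕ) : Label d → Space d :=
  fun s => WithLp.toLp 2 (fun i => if s i then (1 / 2 : ℝ) else -(1 / 2))

/-- The polytope spanned by a labelled family of points. -/
def hull {d : ℕ} (V : Label d → Space d) : Set (Space d) :=
  convexHull ℝ (Set.range V)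

/-- The faces of the polytope spanned by `V` (the empty face and the polytope itself included),
recorded by the labels of the points they contain. -/
def faceSets {d : ℕ} (V : Label d → Space d) : Set (Set (Label d)) :=
  {S | ∃ F : Set (Space d), IsExposed ℝ (hull V) F ∧ S = V ⁻¹' F}

/-- The space of labelled realizations of the combinatorial `d`-cube in `ℝ^d`: families of points
indexed by the vertices of the `d`-cube such that the vertex sets of the faces of the spanned
polytope are exactly the vertex sets of the faces of the standard cube. (Every `V s` is then a
vertex, different labels give different vertices, and the polytope is `d`-dimensional.)
The topology is that of the vertex coordinates. -/
abbrev Realization (d : ℕ) : Type :=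
  {V : Label d → Space d // faceSets V = faceSets (stdCube d)}

/-- The standard cube as a labelled realization. -/
def Realization.std (d : ℕ) : Realization d := ⟨stdCube d, rfl⟩

/-- A projective transformation `x ↦ (A x + b) / (cᵀ x + α)`. -/
structure ProjectiveTransformation (d : ℕ) where
  A : Matrix (Fin d) (Fin d) ℝ
  b : Space d
  c : Space d
  α : ℝ
  det_ne_zero :
    (Matrix.fromBlocks A (Matrix.of fun i (_ : Unit) => b i)
      (Matrix.of fun (_ : Unit) j => c j) (Matrix.of fun (_ _ : Unit) => α)).det ≠ 0

/-- The denominator `cᵀ x + α`. -/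
def ProjectiveTransformation.denom {d : ℕ} (φ : ProjectiveTransformation d) (x : Space d) : ℝ :=
  inner ℝ φ.c x + φ.α

/-- The value of the transformation at `x`; meaningful where the denominator does not vanish. -/
def ProjectiveTransformation.apply {d : ℕ} (φ : ProjectiveTransformation d) (x : Space d) :
    Space d :=
  (φ.denom x)⁻¹ • (WithLp.toLp 2 (φ.A.mulVec x.ofLp) + φ.b)

/-- `W` is the image of `V` under a projective transformation that is defined at every point of
the polytope of `V` (no point of it is sent to infinity). -/
def IsProjectiveStep {d : ℕ} (V W : Realization d) : Prop :=
  ∃ φ : ProjectiveTransformation d,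
    (∀ x ∈ hull V.1, φ.denom x ≠ 0) ∧ ∀ s, W.1 s = φ.apply (V.1 s)

/-- The face of `P` in direction `u`: the points of `P` at which `⟨u, ·⟩` is maximal on `P`. -/
def faceInDirection {d : ℕ} (P : Set (Space d)) (u : Space d) : Set (Space d) :=
  {x ∈ P | ∀ y ∈ P, inner ℝ u y ≤ inner ℝ u x}

/-- The set of (unit) outer normals of the facets, i.e. the `(d - 1)`-dimensional faces,
of a `d`-polytope `P`. -/
def facetNormals {d : ℕ} (P : Set (Space d)) : Set (Space d) :=
  {u | ‖u‖ = 1 ∧ Module.finrank ℝ (vectorSpan ℝ (faceInDirection P u)) + 1 = d}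

/-- `W` arises from `V` by a normal transformation: the two polytopes have the same set of facet
outer normals, and facets with the same outer normal have the same vertex labels (the facial
structure is preserved). -/
def IsNormalStep {d : ℕ} (V W : Realization d) : Prop :=
  facetNormals (hull V.1) = facetNormals (hull W.1) ∧
    ∀ u ∈ facetNormals (hull V.1), ∀ s,
      V.1 s ∈ faceInDirection (hull V.1) u ↔ W.1 s ∈ faceInDirection (hull W.1) u

/-- Congruence of labelled realizations (by an isometry of `ℝ^d`, orientation-reversing ones
included). -/
def congruence (d : ℕ) : Setoid (Realization d) where
  r V W := ∃ g : Space d ≃ᵃⁱ[ℝ] Space d, ∀ s, W.1 s = g (V.1 s)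
  iseqv :=
    { refl := fun _ => ⟨AffineIsometryEquiv.refl ℝ _, fun _ => rfl⟩
      symm := fun ⟨g, hg⟩ => ⟨g.symm, fun s => by simp [hg s]⟩
      trans := fun ⟨g, hg⟩ ⟨h, hh⟩ => ⟨g.trans h, fun s => by simp [hg s, hh s]⟩ }

/-- Affine equivalence of labelled realizations. -/
def affineEquivalence (d : ℕ) : Setoid (Realization d) where
  r V W := ∃ g : Space d ≃ᵃ[ℝ] Space d, ∀ s, W.1 s = g (V.1 s)
  iseqv :=
    { refl := fun _ => ⟨AffineEquiv.refl ℝ _, fun _ => rfl⟩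
      symm := fun ⟨g, hg⟩ => ⟨g.symm, fun s => by simp [hg s]⟩
      trans := fun ⟨g, hg⟩ ⟨h, hh⟩ => ⟨g.trans h, fun s => by simp [hg s, hh s]⟩ }

/-- The realization space of the `d`-cube up to congruence, with the quotient topology. -/
abbrev CongruenceRealizationSpace (d : ℕ) : Type := Quotient (congruence d)

/-- The realization space of the `d`-cube up to affine equivalence, with the quotient topology. -/
abbrev AffineRealizationSpace (d : ℕ) : Type := Quotient (affineEquivalence d)

end NormalProjective

end

/-!
A labelled family `V` is a realization of the cube precisely if it has facet data (`FacetData`):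
functionals `⟨a i b, ·⟩` which attain their maximum over `V` exactly at the labels with `i`-th entry
`b`. At each vertex the `d` edges are then biorthogonal to the normals of the `d` facets through it,
so the polytope lies in the simplicial cone spanned by these edges, and all faces and facet normals
can be read off (`FacetData.mem_faceSets_iff`, `FacetData.mem_facetNormals_iff`).

Fix an interior point `c` of the cube. With the facets scaled to `⟨a i b, x⟩ = 1` relative to `c`,
the `a i b` are the vertices of the polar cross-polytope, whose `d` diagonals join `a i false` to
`a i true`. A perspectivity with center `c` translates the polar (`Frame.shift`), and a normal
transformation scales its vertices one by one. The cube is a parallelepiped if all diagonals have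
the origin as midpoint, so the aim is to make their midpoints coincide.

Suppose that the first `k` diagonals have the common midpoint `p`, and let `q` be the midpoint of
the next one. Choose the pole `o = q + ε (q - p)`, just beyond `q` as seen from `p`, and translate
the polar so that `o` becomes the origin. Now `q` is a positive multiple `l p` of `p` with
`0 < l ≤ 1`, so scaling the two ends of the next diagonal by `1 / l` moves its midpoint to `p` and
leaves the other diagonals alone (`Frame.Aligned.next`). In terms of the cube, the two opposite
facets are pushed inwards, each vertex moving along the edge that joins them. This preserves the
combinatorial type because `p` stays in the interior of the polar: that one inequality keeps each
vertex on its edge and keeps the two facets apart (`Frame.Valid.facetData_squeeze`). The smallness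
of `ε` is needed only for `o` to be interior, and an explicit invariant formula provides it.

Hence `2 d` stages align all diagonals, one further perspectivity produces a parallelepiped, and a
segment from its edge vectors to their Gram–Schmidt orthonormalization gives a cube congruent to the
standard one. The choices are continuous and, up to the orthonormalization, equivariant under all
affine automorphisms; the orthonormalization is equivariant under isometries. The remaining stages
are constant. Running the first `2 d + 1` stages for one cube, an affine map, and the same stages
backwards for another cube gives a chain of `4 d + 3 ≤ 8 d - 1` steps, and the equivariant
deformations descend to contractions of the two quotients, the quotient maps being open.
-/

noncomputable section

namespace NormalProjective

open Set Function InnerProductSpace unitInterval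

variable {d : ℕ}

/-! ### Faces and facet normals -/

/-- The `i`-th neighbour of a vertex label. -/
abbrev neighbour (s : Label d) (i : Fin d) : Label d := update s i (!s i)

/-- The facets of the cube spanned by `V`, one for each direction `i` and each side `b`: the linear
functional `⟨a i b, ·⟩` attains its maximum `h i b` over the family `V` exactly at the labels whose
`i`-th entry is `b`. The normals `a i b` need not be unit vectors. -/
structure FacetData (a : Fin d → Bool → Space d) (h : Fin d → Bool → ℝ)
    (V : Label d → Space d) : Prop where
  eq : ∀ i b s, s i = b → inner ℝ (a i b) (V s) = h i b
  lt : ∀ i b s, s i ≠ b → inner ℝ (a i b) (V s) < h i b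

/-- Vectors `e i` are linearly independent if some `a i` are orthogonal to all `e j` with `j ≠ i`
but not to `e i`. At a vertex of a cube this applies to the edges and the normals of the facets. -/
theorem linearIndependent_of_biorthogonal {a e : Fin d → Space d}
    (h0 : ∀ i j, i ≠ j → inner ℝ (a i) (e j) = 0) (h1 : ∀ i, inner ℝ (a i) (e i) ≠ 0) :
    LinearIndependent ℝ e := by
  rw [Fintype.linearIndependent_iff]
  intro g hg i
  have := congrArg (fun v => inner ℝ (a i) v) hg
  simp only [inner_sum, inner_smul_right, inner_zero_right] at this
  rw [Finset.sum_eq_single i (fun j _ hj => by rw [h0 i j hj.symm, mul_zero]) (by simp)] at this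
  exact (mul_eq_zero.mp this).resolve_right (h1 i)

theorem eq_sum_of_biorthogonal {a e : Fin d → Space d}
    (h0 : ∀ i j, i ≠ j → inner ℝ (a i) (e j) = 0) (h1 : ∀ i, inner ℝ (a i) (e i) ≠ 0)
    (v : Space d) : v = ∑ i, (inner ℝ (a i) v / inner ℝ (a i) (e i)) • e i := by
  have hli := linearIndependent_of_biorthogonal h0 h1
  have hv : v ∈ Submodule.span ℝ (range e) := by
    rw [hli.span_eq_top_of_card_eq_finrank' (by simp)]; trivial
  obtain ⟨c, hc⟩ := (Submodule.mem_span_range_iff_exists_fun ℝ).mp hv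
  rw [← hc]
  refine Finset.sum_congr rfl fun i _ => ?_
  congr 1
  simp only [inner_sum, inner_smul_right]
  rw [Finset.sum_eq_single i (fun j _ hj => by rw [h0 i j hj.symm, mul_zero]) (by simp),
    mul_div_cancel_right₀ _ (h1 i)]

theorem mem_hull (V : Label d → Space d) (s : Label d) : V s ∈ hull V :=
  subset_convexHull ℝ _ ⟨s, rfl⟩

theorem hull_inner_le {V : Label d → Space d} {u : Space d} {m : ℝ}
    (hm : ∀ s, inner ℝ u (V s) ≤ m) {x : Space d} (hx : x ∈ hull V) : inner ℝ u x ≤ m := by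
  have : hull V ⊆ {x | inner ℝ u x ≤ m} := by
    refine convexHull_min ?_ (convex_halfSpace_le ?_ _)
    · rintro _ ⟨s, rfl⟩; exact hm s
    · exact ⟨fun _ _ => inner_add_right _ _ _, fun _ _ => inner_smul_right _ _ _⟩
  exact this hx

namespace FacetData

variable {a : Fin d → Bool → Space d} {h : Fin d → Bool → ℝ} {V : Label d → Space d}

theorem le (H : FacetData a h V) (i : Fin d) (b : Bool) (s : Label d) :
    inner ℝ (a i b) (V s) ≤ h i b := by
  by_cases hs : s i = b
  · exact (H.eq i b s hs).le
  · exact (H.lt i b s hs).le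

theorem eq_iff (H : FacetData a h V) (i : Fin d) (b : Bool) (s : Label d) :
    inner ℝ (a i b) (V s) = h i b ↔ s i = b :=
  ⟨fun e => by_contra fun hs => (H.lt i b s hs).ne e, H.eq i b s⟩

theorem translate (H : FacetData a h V) (c : Space d) :
    FacetData a (fun i b => h i b + inner ℝ (a i b) c) (fun s => c + V s) where
  eq i b s hs := by rw [inner_add_right, H.eq i b s hs, add_comm]
  lt i b s hs := by rw [inner_add_right]; linarith [H.lt i b s hs]

theorem rescale (H : FacetData a h V) {m : Fin d → Bool → ℝ} (hm : ∀ i b, 0 < m i b) :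
    FacetData (fun i b => m i b • a i b) (fun i b => m i b * h i b) V where
  eq i b s hs := by rw [real_inner_smul_left, H.eq i b s hs]
  lt i b s hs := by
    rw [real_inner_smul_left]; exact mul_lt_mul_of_pos_left (H.lt i b s hs) (hm i b)

theorem inner_edge_of_ne (H : FacetData a h V) (s : Label d) {i j : Fin d} (hij : i ≠ j) :
    inner ℝ (a i (s i)) (V (neighbour s j) - V s) = 0 := by
  rw [inner_sub_right, H.eq i (s i) s rfl, H.eq i (s i) _ (by simp [hij]), sub_self]

theorem inner_edge_neg (H : FacetData a h V) (s : Label d) (i : Fin d) :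
    inner ℝ (a i (s i)) (V (neighbour s i) - V s) < 0 := by
  rw [inner_sub_right, H.eq i (s i) s rfl, sub_neg]
  exact H.lt i (s i) _ (by simp)

theorem linearIndependent_edges (H : FacetData a h V) (s : Label d) :
    LinearIndependent ℝ fun j => V (neighbour s j) - V s :=
  linearIndependent_of_biorthogonal (a := fun i => a i (s i))
    (fun _ _ hij => H.inner_edge_of_ne s hij) fun i => (H.inner_edge_neg s i).ne

theorem eq_sum_edges (H : FacetData a h V) (s : Label d) (v : Space d) :
    v = ∑ i, (inner ℝ (a i (s i)) v / inner ℝ (a i (s i)) (V (neighbour s i) - V s)) •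
      (V (neighbour s i) - V s) :=
  eq_sum_of_biorthogonal (a := fun i => a i (s i))
    (fun _ _ hij => H.inner_edge_of_ne s hij) (fun i => (H.inner_edge_neg s i).ne) v

/-- A vector is determined by its inner products with the edges at a vertex. -/
theorem ext_inner_edges (H : FacetData a h V) (s : Label d) {u v : Space d}
    (huv : ∀ i, inner ℝ u (V (neighbour s i) - V s) = inner ℝ v (V (neighbour s i) - V s)) :
    u = v := by
  refine ext_inner_right ℝ fun w => ?_
  rw [H.eq_sum_edges s w]
  simp only [inner_sum, inner_smul_right, huv]

theorem le_of_mem_hull (H : FacetData a h V) (i : Fin d) (b : Bool) {x : Space d}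
    (hx : x ∈ hull V) : inner ℝ (a i b) x ≤ h i b :=
  hull_inner_le (H.le i b) hx

/-- The polytope lies in the cone spanned by the edges at any of its vertices. -/
theorem exists_sum_edges (H : FacetData a h V) (s : Label d) {x : Space d} (hx : x ∈ hull V) :
    ∃ r : Fin d → ℝ, (∀ i, 0 ≤ r i) ∧ (∀ i, r i = 0 ↔ inner ℝ (a i (s i)) x = h i (s i)) ∧
      x - V s = ∑ i, r i • (V (neighbour s i) - V s) := by
  refine ⟨_, fun i => ?_, fun i => ?_, H.eq_sum_edges s (x - V s)⟩
  · refine div_nonneg_of_nonpos ?_ (H.inner_edge_neg s i).le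
    rw [inner_sub_right, H.eq i (s i) s rfl]
    linarith [H.le_of_mem_hull i (s i) hx]
  · rw [div_eq_zero_iff, or_iff_left (H.inner_edge_neg s i).ne, inner_sub_right,
      H.eq i (s i) s rfl, sub_eq_zero]

end FacetData

theorem vertex_mem_faceInDirection {V : Label d → Space d} {u : Space d} {s : Label d} :
    V s ∈ faceInDirection (hull V) u ↔ ∀ t, inner ℝ u (V t) ≤ inner ℝ u (V s) :=
  ⟨fun hs t => hs.2 _ (mem_hull V t), fun hs => ⟨mem_hull V s, fun _ hy => hull_inner_le hs hy⟩⟩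

theorem exists_max_label (V : Label d → Space d) (u : Space d) :
    ∃ s, ∀ t, inner ℝ u (V t) ≤ inner ℝ u (V s) :=
  Finite.exists_max fun s => inner ℝ u (V s)

namespace FacetData

variable {a : Fin d → Bool → Space d} {h h' : Fin d → Bool → ℝ} {V W : Label d → Space d}

/-- A face is a subcube: once it contains the vertex `s`, a vertex `t` lies in it precisely if `t`
differs from `s` only in the directions of edges at `s` that are parallel to the face. -/
theorem vertex_mem_face_iff (H : FacetData a h V) {u : Space d} {s : Label d}
    (hs : ∀ t, inner ℝ u (V t) ≤ inner ℝ u (V s)) (t : Label d) :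
    (∀ t', inner ℝ u (V t') ≤ inner ℝ u (V t)) ↔
      ∀ j, inner ℝ u (V (neighbour s j) - V s) ≠ 0 → t j = s j := by
  have hneg : ∀ j, inner ℝ u (V (neighbour s j) - V s) ≤ 0 := fun j => by
    rw [inner_sub_right]; linarith [hs (neighbour s j)]
  obtain ⟨r, hr0, hr, hsum⟩ := H.exists_sum_edges s (mem_hull V t)
  have key : inner ℝ u (V t) - inner ℝ u (V s) =
      ∑ i, r i * inner ℝ u (V (neighbour s i) - V s) := by
    rw [← inner_sub_right, hsum, inner_sum]
    simp only [inner_smul_right]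
  have hmax : (∀ t', inner ℝ u (V t') ≤ inner ℝ u (V t)) ↔
      inner ℝ u (V t) - inner ℝ u (V s) = 0 :=
    ⟨fun ht => by linarith [ht s, hs t], fun ht t' => by linarith [hs t']⟩
  rw [hmax, key, Finset.sum_eq_zero_iff_of_nonpos
    fun i _ => mul_nonpos_of_nonneg_of_nonpos (hr0 i) (hneg i)]
  simp only [Finset.mem_univ, true_imp_iff, mul_eq_zero, hr, H.eq_iff]
  exact forall_congr' fun j => or_iff_not_imp_right

theorem mem_faceSets_iff (H : FacetData a h V) (S : Set (Label d)) :
    S ∈ faceSets V ↔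
      S = ∅ ∨ ∃ (s : Label d) (J : Set (Fin d)), S = {t | ∀ j ∈ J, t j = s j} := by
  constructor
  · rintro ⟨F, hF, rfl⟩
    rcases F.eq_empty_or_nonempty with rfl | hne
    · exact Or.inl rfl
    obtain ⟨l, hl⟩ := hF hne
    set u := (InnerProductSpace.toDual ℝ (Space d)).symm l with hu
    have hul : ∀ y, l y = inner ℝ u y := fun y => by
      rw [hu, InnerProductSpace.toDual_symm_apply]
    have hFu : F = faceInDirection (hull V) u := by
      rw [hl]; simp only [hul]; rfl
    obtain ⟨s, hs⟩ := exists_max_label V u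
    refine Or.inr ⟨s, {j | inner ℝ u (V (neighbour s j) - V s) ≠ 0}, ?_⟩
    ext t
    rw [mem_preimage, hFu, vertex_mem_faceInDirection, H.vertex_mem_face_iff hs]
    rfl
  · rintro (rfl | ⟨s, J, rfl⟩)
    · exact ⟨∅, fun h => absurd h (by simp), rfl⟩
    classical
    set u : Space d := ∑ j, if j ∈ J then a j (s j) else 0 with hu
    have huv : ∀ v, inner ℝ u v = ∑ j, if j ∈ J then inner ℝ (a j (s j)) v else 0 := fun v => by
      rw [hu, sum_inner]
      refine Finset.sum_congr rfl fun j _ => ?_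
      split_ifs <;> simp
    have hs : ∀ t, inner ℝ u (V t) ≤ inner ℝ u (V s) := fun t => by
      rw [huv, huv]
      refine Finset.sum_le_sum fun j _ => ?_
      split_ifs
      · rw [H.eq j (s j) s rfl]; exact H.le _ _ _
      · exact le_rfl
    refine ⟨faceInDirection (hull V) u, fun _ => ⟨innerSL ℝ u, rfl⟩, ?_⟩
    ext t
    rw [mem_preimage, vertex_mem_faceInDirection, H.vertex_mem_face_iff hs]
    refine forall_congr' fun j => ?_
    have : inner ℝ u (V (neighbour s j) - V s) ≠ 0 ↔ j ∈ J := by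
      rw [huv, Finset.sum_eq_single j (fun i _ hij => by
        rw [H.inner_edge_of_ne s hij, ite_self]) (by simp)]
      split_ifs with hj
      · simp [hj, (H.inner_edge_neg s j).ne]
      · simp [hj]
    rw [this]

end FacetData

theorem stdCube_facetData :
    FacetData (fun i b => (if b then (1 : ℝ) else -1) • EuclideanSpace.single i (1 : ℝ))
      (fun _ _ => 1 / 2) (stdCube d) where
  eq i b s hs := by
    rw [real_inner_smul_left, EuclideanSpace.inner_single_left]
    subst hs
    cases hs : s i <;> simp [stdCube, hs]
  lt i b s hs := by
    rw [real_inner_smul_left, EuclideanSpace.inner_single_left]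
    cases hb : b <;> cases hs' : s i <;> simp_all [stdCube]

/-- The label sets of the faces do not depend on the facet data, so every family with facet data is
a realization of the cube. -/
theorem FacetData.faceSets_eq {a : Fin d → Bool → Space d} {h : Fin d → Bool → ℝ}
    {V : Label d → Space d} (H : FacetData a h V) : faceSets V = faceSets (stdCube d) := by
  ext S
  rw [H.mem_faceSets_iff, stdCube_facetData.mem_faceSets_iff]

theorem exists_facetData (V : Realization d) : ∃ a h, FacetData a h V.1 := by
  have key : ∀ (i : Fin d) (b : Bool), ∃ (u : Space d) (m : ℝ), ∀ s,
      (s i = b → inner ℝ u (V.1 s) = m) ∧ (s i ≠ b → inner ℝ u (V.1 s) < m) := by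
    intro i b
    have hmem : {t : Label d | t i = b} ∈ faceSets V.1 := by
      rw [V.2, stdCube_facetData.mem_faceSets_iff]
      exact Or.inr ⟨fun _ => b, {i}, by simp⟩
    obtain ⟨F, hF, hSF⟩ := hmem
    have hiff : ∀ s : Label d, s i = b ↔ V.1 s ∈ F := fun s => by
      rw [← mem_preimage, ← hSF]; rfl
    have hb : V.1 (fun _ => b) ∈ F := (hiff _).1 rfl
    obtain ⟨l, hl⟩ := hF ⟨_, hb⟩
    have hmem : ∀ s, V.1 s ∈ F ↔ ∀ y ∈ hull V.1, l y ≤ l (V.1 s) := fun s => by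
      rw [hl]; exact and_iff_right (mem_hull _ _)
    rw [hmem] at hb
    refine ⟨(InnerProductSpace.toDual ℝ (Space d)).symm l, l (V.1 fun _ => b), fun s => ?_⟩
    rw [InnerProductSpace.toDual_symm_apply, ne_eq, hiff, hmem]
    refine ⟨fun hs => le_antisymm (hb _ (mem_hull _ _)) (hs _ (mem_hull _ _)), fun hs => ?_⟩
    by_contra hlt
    exact hs fun y hy => (hb y hy).trans (not_lt.mp hlt)
  choose a h hah using key
  exact ⟨a, h, ⟨fun i b s => (hah i b s).1, fun i b s => (hah i b s).2⟩⟩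

namespace FacetData

variable {a : Fin d → Bool → Space d} {h h' : Fin d → Bool → ℝ} {V W : Label d → Space d}

/-- The direction of a face is spanned by the edges along it at any of its vertices. -/
theorem vectorSpan_face (H : FacetData a h V) {u : Space d} {s : Label d}
    (hs : ∀ t, inner ℝ u (V t) ≤ inner ℝ u (V s)) :
    vectorSpan ℝ (faceInDirection (hull V) u) = Submodule.span ℝ
      (range fun j : {j // inner ℝ u (V (neighbour s j) - V s) = 0} =>
        V (neighbour s j) - V s) := by
  have hneg : ∀ j, inner ℝ u (V (neighbour s j) - V s) ≤ 0 := fun j => by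
    rw [inner_sub_right]; linarith [hs (neighbour s j)]
  have hsF : V s ∈ faceInDirection (hull V) u := vertex_mem_faceInDirection.2 hs
  apply le_antisymm
  · rw [vectorSpan_eq_span_vsub_set_right ℝ hsF, Submodule.span_le]
    rintro _ ⟨x, hx, rfl⟩
    obtain ⟨r, hr0, -, hsum⟩ := H.exists_sum_edges s hx.1
    have key : ∑ i, r i * inner ℝ u (V (neighbour s i) - V s) = 0 := by
      have h1 := hx.2 _ hsF.1
      have h2 := hsF.2 _ hx.1
      have h3 : inner ℝ u (x - V s) = ∑ i, r i * inner ℝ u (V (neighbour s i) - V s) := by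
        rw [hsum, inner_sum]; simp only [inner_smul_right]
      rw [← h3, inner_sub_right]; linarith
    rw [Finset.sum_eq_zero_iff_of_nonpos
      fun i _ => mul_nonpos_of_nonneg_of_nonpos (hr0 i) (hneg i)] at key
    simp only [vsub_eq_sub, SetLike.mem_coe]
    rw [hsum]
    refine Submodule.sum_mem _ fun i _ => ?_
    rcases mul_eq_zero.mp (key i (Finset.mem_univ i)) with hi | hi
    · rw [hi, zero_smul]; exact Submodule.zero_mem _
    · exact Submodule.smul_mem _ _ (Submodule.subset_span ⟨⟨i, hi⟩, rfl⟩)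
  · rw [Submodule.span_le]
    rintro _ ⟨⟨j, hj⟩, rfl⟩
    refine vsub_mem_vectorSpan ℝ (vertex_mem_faceInDirection.2 fun t => ?_) hsF
    rw [inner_sub_right, sub_eq_zero] at hj
    rw [hj]; exact hs t

/-- By the linear independence of the edges a face is a facet precisely if all but one of the edges
at a vertex lie along it, and then its normal is determined up to scaling. -/
theorem mem_facetNormals_iff (H : FacetData a h V) (u : Space d) :
    u ∈ facetNormals (hull V) ↔ ‖u‖ = 1 ∧ ∃ i b, ∃ r : ℝ, 0 < r ∧ u = r • a i b := by
  classical
  refine and_congr_right fun _ => ?_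
  have hrank : ∀ s, (∀ t, inner ℝ u (V t) ≤ inner ℝ u (V s)) →
      (Module.finrank ℝ (vectorSpan ℝ (faceInDirection (hull V) u)) + 1 = d ↔
        ∃ i, ∀ j, inner ℝ u (V (neighbour s j) - V s) ≠ 0 ↔ j = i) := by
    intro s hs
    have hli : LinearIndependent ℝ
        fun j : {j // inner ℝ u (V (neighbour s j) - V s) = 0} => V (neighbour s j) - V s :=
      (H.linearIndependent_edges s).comp _ Subtype.val_injective
    rw [H.vectorSpan_face hs, finrank_span_eq_card hli]
    have h1 := Fintype.card_subtype_compl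
      (fun j => inner ℝ u (V (neighbour s j) - V s) = 0)
    have h2 := Fintype.card_subtype_le
      (fun j => inner ℝ u (V (neighbour s j) - V s) = 0)
    rw [Fintype.card_fin] at h1 h2
    have h3 : Fintype.card {j // ¬ inner ℝ u (V (neighbour s j) - V s) = 0} = 1 ↔
        ∃ i, ∀ j, inner ℝ u (V (neighbour s j) - V s) ≠ 0 ↔ j = i := by
      rw [Fintype.card_subtype, Finset.card_eq_one]
      refine exists_congr fun i => ?_
      simp [Finset.ext_iff]
    rw [← h3, h1]
    omega
  constructor
  · intro hu
    obtain ⟨s, hs⟩ := exists_max_label V u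
    obtain ⟨i, hi⟩ := (hrank s hs).1 hu
    have hne := (hi i).2 rfl
    have hlt : inner ℝ u (V (neighbour s i) - V s) < 0 :=
      lt_of_le_of_ne (by rw [inner_sub_right]; linarith [hs (neighbour s i)]) hne
    refine ⟨i, s i, _, div_pos_of_neg_of_neg hlt (H.inner_edge_neg s i),
      H.ext_inner_edges s fun j => ?_⟩
    rw [real_inner_smul_left]
    by_cases hj : j = i
    · subst hj; rw [div_mul_cancel₀ _ (H.inner_edge_neg s j).ne]
    · rw [H.inner_edge_of_ne s (Ne.symm hj), mul_zero]
      exact not_not.mp fun hc => hj ((hi j).1 hc)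
  · rintro ⟨i, b, r, hr, rfl⟩
    have hs : ∀ t, inner ℝ (r • a i b) (V t) ≤ inner ℝ (r • a i b) (V fun _ => b) := fun t => by
      rw [real_inner_smul_left, real_inner_smul_left, H.eq i b (fun _ => b) rfl]
      exact mul_le_mul_of_nonneg_left (H.le i b t) hr.le
    refine (hrank _ hs).2 ⟨i, fun j => ?_⟩
    rw [real_inner_smul_left]
    by_cases hj : j = i
    · subst hj
      have := (H.inner_edge_neg (fun _ => b) j).ne
      simp only [ne_eq, mul_eq_zero, hr.ne', false_or, iff_true]
      exact this
    · have := H.inner_edge_of_ne (fun _ => b) (Ne.symm hj)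
      exact iff_of_false (not_not.mpr (mul_eq_zero_of_right _ this)) hj

/-- Two cubes whose facets have the same outer normals, label by label, differ by a normal
transformation; the positions of the facet hyperplanes are irrelevant. -/
theorem isNormalStep {V W : Realization d} (H : FacetData a h V.1) (H' : FacetData a h' W.1) :
    IsNormalStep V W := by
  refine ⟨?_, fun u hu s => ?_⟩
  · ext u; rw [H.mem_facetNormals_iff, H'.mem_facetNormals_iff]
  · obtain ⟨-, i, b, r, hr, rfl⟩ := (H.mem_facetNormals_iff u).1 hu
    have key : ∀ {h : Fin d → Bool → ℝ} {V : Label d → Space d}, FacetData a h V →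
        (V s ∈ faceInDirection (hull V) (r • a i b) ↔ s i = b) := by
      intro h V H
      simp only [vertex_mem_faceInDirection, real_inner_smul_left, mul_le_mul_iff_right₀ hr]
      constructor
      · intro hm
        rw [← H.eq_iff]
        exact le_antisymm (H.le _ _ _) ((H.eq i b (fun _ => b) rfl).symm.le.trans (hm _))
      · intro hs t
        rw [H.eq i b s hs]; exact H.le _ _ _
    rw [key H, key H']

end FacetData

/-! ### Projective transformations -/

theorem isProjectiveStep_of_affineEquiv {V W : Realization d} (g : Space d ≃ᵃ[ℝ] Space d)
    (hg : ∀ s, W.1 s = g (V.1 s)) : IsProjectiveStep V W := by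
  let A : Matrix (Fin d) (Fin d) ℝ := Matrix.toEuclideanLin.symm (g.linear : Space d →ₗ[ℝ] Space d)
  have hA : ∀ x : Space d, WithLp.toLp 2 (A.mulVec x.ofLp) = g.linear x := fun x => by
    rw [← Matrix.toLpLin_apply]
    simp [A]
  have hdet : A.det ≠ 0 := by
    intro h0
    obtain ⟨v, hv, hAv⟩ := Matrix.exists_mulVec_eq_zero_iff.mpr h0
    have := hA (WithLp.toLp 2 v)
    rw [hAv] at this
    have h2 := (LinearEquiv.map_eq_zero_iff g.linear).mp this.symm
    exact hv (by simpa using congrArg WithLp.ofLp h2)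
  refine ⟨⟨A, g 0, 0, 1, ?_⟩, fun x _ => by simp [ProjectiveTransformation.denom], fun s => ?_⟩
  · have : (Matrix.of fun (_ : Unit) j => (0 : Space d) j) = 0 := by ext; simp
    rw [this, Matrix.det_fromBlocks_zero₂₁]
    simpa using hdet
  · have := g.map_vadd 0 (V.1 s)
    simp only [vadd_eq_add, add_zero] at this
    simp [ProjectiveTransformation.apply, ProjectiveTransformation.denom, hA, hg, this]

/-- The projective transformation `c + x ↦ c + x / (1 - ⟨o, x⟩)`, which fixes `c` and sends the
hyperplane `⟨o, x⟩ = 1` to infinity. -/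
def perspectivity (c o : Space d) : ProjectiveTransformation d where
  A := 1 - Matrix.vecMulVec c.ofLp o.ofLp
  b := inner ℝ o c • c
  c := -o
  α := 1 + inner ℝ o c
  det_ne_zero := by
    -- The matrix is the elementary matrix with lower left entry `-o`, conjugated by the
    -- translation by `c`.
    let col : Space d → Matrix (Fin d) Unit ℝ := fun v => Matrix.of fun i _ => v i
    let row : Space d → Matrix Unit (Fin d) ℝ := fun v => Matrix.of fun _ j => v j
    have key : Matrix.fromBlocks (1 - Matrix.vecMulVec c.ofLp o.ofLp)
        (col (inner ℝ o c • c)) (row (-o)) (Matrix.of fun _ _ => 1 + inner ℝ o c) =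
        Matrix.fromBlocks 1 (col c) 0 1 * Matrix.fromBlocks 1 0 (row (-o)) 1 *
          Matrix.fromBlocks 1 (col (-c)) 0 1 := by
      rw [Matrix.fromBlocks_multiply, Matrix.fromBlocks_multiply]
      congr 1
      · ext i j; simp [col, row, Matrix.mul_apply, Matrix.vecMulVec_apply, sub_eq_add_neg]
      · ext i j
        simp [col, row, Matrix.mul_apply, PiLp.inner_apply, Matrix.add_apply, add_mul,
          Finset.sum_mul, Matrix.one_apply, Finset.sum_add_distrib]
        exact Finset.sum_congr rfl fun _ _ => by ring
      · ext i j; simp [row]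
      · ext i j
        simp only [row, col, Matrix.mul_apply, PiLp.inner_apply, Matrix.add_apply]
        simp
        rw [add_comm]
        exact congrArg (· + 1) (Finset.sum_congr rfl fun _ _ => mul_comm _ _)
    change (Matrix.fromBlocks (1 - Matrix.vecMulVec c.ofLp o.ofLp)
        (col (inner ℝ o c • c)) (row (-o)) (Matrix.of fun _ _ => 1 + inner ℝ o c)).det ≠ 0
    rw [key, Matrix.det_mul, Matrix.det_mul]
    simp

theorem perspectivity_denom (c o x : Space d) :
    (perspectivity c o).denom x = 1 - inner ℝ o (x - c) := by
  simp only [ProjectiveTransformation.denom, perspectivity, inner_neg_left, inner_sub_right]; ring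

theorem perspectivity_apply (c o x : Space d) (hx : inner ℝ o x ≠ 1) :
    (perspectivity c o).apply (c + x) = c + (1 - inner ℝ o x)⁻¹ • x := by
  have hx' : 1 - inner ℝ o x ≠ 0 := sub_ne_zero.mpr hx.symm
  have hA : WithLp.toLp 2 ((perspectivity c o).A.mulVec (c + x).ofLp) =
      c + x - inner ℝ o (c + x) • c := by
    ext i
    simp [perspectivity, Matrix.sub_mulVec, Matrix.vecMulVec_mulVec, PiLp.inner_apply, dotProduct]
    rw [mul_comm]
    exact congrArg (· * c i) (Finset.sum_congr rfl fun _ _ => mul_comm _ _)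
  rw [ProjectiveTransformation.apply, hA, perspectivity_denom, add_sub_cancel_left,
    inv_smul_eq_iff₀ hx', smul_add, smul_smul, mul_inv_cancel₀ hx', one_smul]
  simp only [perspectivity, inner_add_right]
  module

theorem isProjectiveStep_of_perspectivity {V W : Realization d} {c o : Space d}
    {x : Label d → Space d} (hx : ∀ s, inner ℝ o (x s) < 1) (hV : ∀ s, V.1 s = c + x s)
    (hW : ∀ s, W.1 s = c + (1 - inner ℝ o (x s))⁻¹ • x s) : IsProjectiveStep V W := by
  refine ⟨perspectivity c o, fun y hy => ?_, fun s => ?_⟩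
  · have hmax : ∀ s, inner ℝ o (V.1 s) < 1 + inner ℝ o c := fun s => by
      rw [hV, inner_add_right]; linarith [hx s]
    obtain ⟨s, hs⟩ := exists_max_label V.1 o
    have := hull_inner_le hs hy
    rw [perspectivity_denom, inner_sub_right]
    linarith [hmax s]
  · rw [hV, hW, perspectivity_apply c o _ (hx s).ne]

/-- The inverse of the perspectivity given by `o` is the one given by `-o`. -/
theorem isProjectiveStep_of_perspectivity_symm {V W : Realization d} {c o : Space d}
    {x : Label d → Space d} (hx : ∀ s, inner ℝ o (x s) < 1) (hV : ∀ s, V.1 s = c + x s)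
    (hW : ∀ s, W.1 s = c + (1 - inner ℝ o (x s))⁻¹ • x s) : IsProjectiveStep W V := by
  have key : ∀ s, 1 - inner ℝ (-o) ((1 - inner ℝ o (x s))⁻¹ • x s) = (1 - inner ℝ o (x s))⁻¹ :=
    fun s => by
      have : 1 - inner ℝ o (x s) ≠ 0 := (sub_pos.mpr (hx s)).ne'
      rw [inner_neg_left, inner_smul_right]; field_simp; ring
  refine isProjectiveStep_of_perspectivity (o := -o) (fun s => ?_) hW fun s => ?_
  · rw [← sub_pos, key, inv_pos, sub_pos]; exact hx s
  · rw [key, hV, inv_inv, smul_smul, mul_inv_cancel₀ (sub_pos.mpr (hx s)).ne', one_smul]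

/-! ### Frames and the two moves -/

/-- A cube together with the data used to deform it: a base point `c`, the positions `x s` of the
vertices relative to `c`, the facet normals `a i b` scaled so that the facets are
`⟨a i b, x⟩ = 1` (that is, the vertices of the polar cross-polytope with respect to `c`), and a
point `p` of the polar. -/
structure Frame (d : ℕ) where
  c : Space d
  x : Label d → Space d
  a : Fin d → Bool → Space d
  p : Space d

namespace Frame

/-- The vertices `x s` and the facet normals `a i b` belong to a cube with the origin in its
interior, and `p` is an interior point of its polar. -/
structure Valid (X : Frame d) : Prop where
  facet : FacetData X.a (fun _ _ => 1) X.x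
  p_lt : ∀ s, inner ℝ X.p (X.x s) < 1

/-- The cube recorded by a frame. -/
def realize (X : Frame d) (hX : X.Valid) : Realization d :=
  ⟨fun s => X.c + X.x s, (hX.facet.translate X.c).faceSets_eq⟩

/-- A family of frames is continuous if all its components are. -/
structure ContinuousFamily {T : Type*} [TopologicalSpace T] (X : T → Frame d) : Prop where
  c : Continuous fun t => (X t).c
  x : ∀ s, Continuous fun t => (X t).x s
  a : ∀ i b, Continuous fun t => (X t).a i b
  p : Continuous fun t => (X t).p

/-- `Y` is the image of `X` under the affine automorphism `g`: points are moved by `g`, vectors of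
the polar by the inverse transpose of its linear part. -/
structure Related (g : Space d ≃ᵃ[ℝ] Space d) (X Y : Frame d) : Prop where
  c : Y.c = g X.c
  x : ∀ s, Y.x s = g.linear (X.x s)
  a : ∀ i b v, inner ℝ (Y.a i b) (g.linear v) = inner ℝ (X.a i b) v
  p : ∀ v, inner ℝ Y.p (g.linear v) = inner ℝ X.p v

theorem Related.vertex {g : Space d ≃ᵃ[ℝ] Space d} {X Y : Frame d} (h : Related g X Y)
    (s : Label d) : Y.c + Y.x s = g (X.c + X.x s) := by
  rw [h.c, h.x, add_comm, add_comm X.c]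
  exact (g.map_vadd X.c (X.x s)).symm

theorem ContinuousFamily.comp {T T' : Type*} [TopologicalSpace T] [TopologicalSpace T']
    {X : T → Frame d} (hX : ContinuousFamily X) {f : T' → T} (hf : Continuous f) :
    ContinuousFamily fun t => X (f t) :=
  ⟨hX.c.comp hf, fun s => (hX.x s).comp hf, fun i b => (hX.a i b).comp hf, hX.p.comp hf⟩

theorem ContinuousFamily.realize {T : Type*} [TopologicalSpace T] {X : T → Frame d}
    (hX : ContinuousFamily X) (hv : ∀ t, (X t).Valid) :
    Continuous fun t => (X t).realize (hv t) :=
  Continuous.subtype_mk (continuous_pi fun s => hX.c.add (hX.x s)) _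

/-- The perspectivity which moves the origin of the polar to `o`. -/
def shift (o : Space d) (X : Frame d) : Frame d where
  c := X.c
  x s := (1 - inner ℝ o (X.x s))⁻¹ • X.x s
  a i b := X.a i b - o
  p := X.p - o

/-- A point lies on the same side of a hyperplane before and after a perspectivity with positive
denominator. -/
theorem inner_sub_perspective {o u x : Space d} (h : inner ℝ o x < 1) :
    inner ℝ (u - o) ((1 - inner ℝ o x)⁻¹ • x) = 1 - (1 - inner ℝ u x) / (1 - inner ℝ o x) := by
  have : 1 - inner ℝ o x ≠ 0 := (sub_pos.mpr h).ne'
  rw [inner_smul_right, inner_sub_left]; field_simp; ring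

theorem Valid.shift {X : Frame d} (hX : X.Valid) {o : Space d}
    (ho : ∀ s, inner ℝ o (X.x s) < 1) : (X.shift o).Valid where
  facet :=
    { eq := fun i b s hs => by
        simp only [Frame.shift]
        rw [inner_sub_perspective (ho s), hX.facet.eq i b s hs, sub_self, zero_div, sub_zero]
      lt := fun i b s hs => by
        simp only [Frame.shift]
        rw [inner_sub_perspective (ho s)]
        linarith [div_pos (sub_pos.mpr (hX.facet.lt i b s hs)) (sub_pos.mpr (ho s))] }
  p_lt s := by
    simp only [Frame.shift]
    rw [inner_sub_perspective (ho s)]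
    linarith [div_pos (sub_pos.mpr (hX.p_lt s)) (sub_pos.mpr (ho s))]

theorem ContinuousFamily.shift {T : Type*} [TopologicalSpace T] {X : T → Frame d}
    (hX : ContinuousFamily X) {o : T → Space d} (ho : Continuous o)
    (hlt : ∀ t s, inner ℝ (o t) ((X t).x s) < 1) :
    ContinuousFamily fun t => (X t).shift (o t) where
  c := hX.c
  x s := ((continuous_const.sub (ho.inner (hX.x s))).inv₀
    fun t => (sub_pos.mpr (hlt t s)).ne').smul (hX.x s)
  a i b := (hX.a i b).sub ho
  p := hX.p.sub ho

theorem Related.shift {g : Space d ≃ᵃ[ℝ] Space d} {X Y : Frame d} (h : Related g X Y)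
    {o o' : Space d} (ho : ∀ v, inner ℝ o' (g.linear v) = inner ℝ o v) :
    Related g (X.shift o) (Y.shift o') where
  c := h.c
  x s := by simp only [Frame.shift]; rw [h.x, ho, map_smul]
  a i b v := by simp only [Frame.shift]; rw [inner_sub_left, inner_sub_left, h.a, ho]
  p v := by simp only [Frame.shift]; rw [inner_sub_left, inner_sub_left, h.p, ho]

/-- Move the two opposite facets in direction `j` to the height `m` while keeping the other facet
hyperplanes: every vertex moves along its edge in direction `j`. -/
def squeeze (j : Fin d) (m : ℝ) (X : Frame d) : Frame d where
  c := X.c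
  x s := X.x s + ((1 - m) / (1 - inner ℝ (X.a j (s j)) (X.x (neighbour s j)))) •
    (X.x (neighbour s j) - X.x s)
  a i b := (if i = j then m⁻¹ else 1) • X.a i b
  p := X.p

theorem Valid.inner_neighbour_lt {X : Frame d} (hX : X.Valid) (j : Fin d) (s : Label d) :
    inner ℝ (X.a j (s j)) (X.x (neighbour s j)) < 1 :=
  hX.facet.lt j (s j) _ (by simp)

/-- If `l p`, with `0 < l ≤ 1`, is the midpoint of the diagonal `j` of the polar, then the two
facets in direction `j` can be moved inwards to any height between `l` and `1` without changing the
combinatorial type. The normals need not be rescaled. -/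
theorem Valid.facetData_squeeze {X : Frame d} (hX : X.Valid) {j : Fin d} {l m : ℝ} (hl : 0 < l)
    (hlm : l ≤ m) (hm : m ≤ 1) (hj : X.a j true + X.a j false = (2 * l) • X.p) :
    FacetData X.a (fun i _ => if i = j then m else 1) (X.squeeze j m).x ∧
      ∀ s, inner ℝ X.p ((X.squeeze j m).x s) < 1 := by
  have hsum : ∀ b v, inner ℝ (X.a j b) v + inner ℝ (X.a j (!b)) v = 2 * l * inner ℝ X.p v := by
    intro b v
    rw [← real_inner_smul_left, ← hj, ← inner_add_left]
    cases b
    · rw [add_comm]; rfl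
    · rfl
  -- `r s` is the fraction of the edge in direction `j` that the vertex `s` has travelled.
  set r : Label d → ℝ := fun s => (1 - m) / (1 - inner ℝ (X.a j (s j)) (X.x (neighbour s j)))
    with hr
  have hpos : ∀ s, 0 < 1 - inner ℝ (X.a j (s j)) (X.x (neighbour s j)) := fun s =>
    sub_pos.mpr (hX.inner_neighbour_lt j s)
  have hr0 : ∀ s, 0 ≤ r s := fun s => div_nonneg (sub_nonneg.mpr hm) (hpos s).le
  have hr1 : ∀ s, r s ≤ 1 := fun s => by
    refine (div_le_one (hpos s)).2 ?_
    have h1 := hsum (s j) (X.x (neighbour s j))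
    rw [hX.facet.eq j (!s j) (neighbour s j) (by simp)] at h1
    -- The far end of the edge has height `2 * l * ⟨p, ·⟩ - 1 < 2 * l - 1 ≤ m`.
    nlinarith [hX.p_lt (neighbour s j)]
  have hx : ∀ u s, inner ℝ u ((X.squeeze j m).x s) =
      (1 - r s) * inner ℝ u (X.x s) + r s * inner ℝ u (X.x (neighbour s j)) := by
    intro u s
    simp only [squeeze]
    rw [inner_add_right, inner_smul_right, inner_sub_right]
    ring
  have hconv : ∀ s {y z : ℝ}, y < 1 → z < 1 → (1 - r s) * y + r s * z < 1 := by
    intro s y z hy hz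
    rcases (hr0 s).eq_or_lt with h | h
    · rw [← h]; linarith
    · nlinarith [mul_lt_mul_of_pos_left hz h,
        mul_le_mul_of_nonneg_left hy.le (sub_nonneg.mpr (hr1 s))]
  have hp : ∀ s, inner ℝ X.p ((X.squeeze j m).x s) < 1 := fun s => by
    rw [hx]; exact hconv s (hX.p_lt s) (hX.p_lt _)
  have hjs : ∀ s, inner ℝ (X.a j (s j)) ((X.squeeze j m).x s) = m := fun s => by
    rw [hx, hX.facet.eq j (s j) s rfl]
    have := (hpos s).ne'
    simp only [hr]
    field_simp
    ring
  refine ⟨⟨fun i b s hs => ?_, fun i b s hs => ?_⟩, hp⟩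
  · subst hs
    split_ifs with hij
    · rw [hij, hjs]
    · rw [hx, hX.facet.eq i (s i) s rfl, hX.facet.eq i (s i) _ (by simp [hij])]; ring
  · split_ifs with hij
    · subst hij
      have hb : b = !s i := by cases b <;> cases h : s i <;> simp_all
      have h1 := hsum (s i) ((X.squeeze i m).x s)
      rw [hjs, ← hb] at h1
      -- The opposite height is `2 * l * ⟨p, ·⟩ - m < 2 * l - m ≤ m`.
      nlinarith [hp s]
    · rw [hx]
      exact hconv s (hX.facet.lt i b s hs) (hX.facet.lt i b _ (by simpa [hij] using hs))

theorem Valid.squeeze {X : Frame d} (hX : X.Valid) {j : Fin d} {l m : ℝ} (hl : 0 < l)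
    (hlm : l ≤ m) (hm : m ≤ 1) (hj : X.a j true + X.a j false = (2 * l) • X.p) :
    (X.squeeze j m).Valid := by
  obtain ⟨h1, h2⟩ := hX.facetData_squeeze hl hlm hm hj
  have hm0 : 0 < m := hl.trans_le hlm
  refine ⟨?_, h2⟩
  convert h1.rescale (m := fun i _ => if i = j then m⁻¹ else 1)
    (fun i _ => by split_ifs <;> positivity) using 1
  · rfl
  funext i b
  split_ifs
  · exact (inv_mul_cancel₀ hm0.ne').symm
  · exact (one_mul 1).symm

theorem ContinuousFamily.squeeze {T : Type*} [TopologicalSpace T] {X : T → Frame d}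
    (hX : ContinuousFamily X) (hv : ∀ t, (X t).Valid) (j : Fin d) {m : T → ℝ} (hm : Continuous m)
    (hm0 : ∀ t, 0 < m t) : ContinuousFamily fun t => (X t).squeeze j (m t) where
  c := hX.c
  x s := (hX.x s).add (((continuous_const.sub hm).div
    (continuous_const.sub ((hX.a j (s j)).inner (hX.x _)))
    fun t => (sub_pos.mpr ((hv t).inner_neighbour_lt j s)).ne').smul ((hX.x _).sub (hX.x s)))
  a i b := by
    simp only [Frame.squeeze]
    split_ifs
    · exact (hm.inv₀ fun t => (hm0 t).ne').smul (hX.a i b)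
    · exact (hX.a i b).const_smul (1 : ℝ)
  p := hX.p

theorem Related.squeeze {g : Space d ≃ᵃ[ℝ] Space d} {X Y : Frame d} (h : Related g X Y)
    (j : Fin d) (m : ℝ) : Related g (X.squeeze j m) (Y.squeeze j m) where
  c := h.c
  x s := by
    simp only [Frame.squeeze]
    rw [h.x, h.x, h.a, map_add, map_smul, map_sub]
  a i b v := by simp only [Frame.squeeze]; rw [real_inner_smul_left, real_inner_smul_left, h.a]
  p := h.p

/-- The midpoint of the `i`-th diagonal of the polar cross-polytope. -/
def diag (X : Frame d) (i : Fin d) : Space d := (1 / 2 : ℝ) • (X.a i true + X.a i false)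

/-- A positive number, small enough for `Frame.pole` to stay in the interior of the polar, and
depending continuously and affinely invariantly on the frame. -/
def eps (X : Frame d) (i : Fin d) : ℝ :=
  (1 + ∑ s, |inner ℝ (X.diag i - X.p) (X.x s)| / (1 - inner ℝ (X.diag i) (X.x s)))⁻¹

/-- A point slightly beyond the midpoint of the `i`-th diagonal, on the ray that comes from `p`. -/
def pole (X : Frame d) (i : Fin d) : Space d := X.diag i + X.eps i • (X.diag i - X.p)

/-- The ratio in which, seen from the pole, the midpoint of the `i`-th diagonal divides the segment
to `p`. -/
def ratio (X : Frame d) (i : Fin d) : ℝ := X.eps i / (1 + X.eps i)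

theorem Valid.diag_lt {X : Frame d} (hX : X.Valid) (i : Fin d) (s : Label d) :
    inner ℝ (X.diag i) (X.x s) < 1 := by
  rw [diag, real_inner_smul_left, inner_add_left]
  cases hs : s i
  · linarith [hX.facet.lt i true s (by simp [hs]), hX.facet.le i false s]
  · linarith [hX.facet.lt i false s (by simp [hs]), hX.facet.le i true s]

theorem Valid.eps_pos {X : Frame d} (hX : X.Valid) (i : Fin d) : 0 < X.eps i := by
  refine inv_pos.mpr (add_pos_of_pos_of_nonneg one_pos (Finset.sum_nonneg fun s _ => ?_))
  exact div_nonneg (abs_nonneg _) (sub_pos.mpr (hX.diag_lt i s)).le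

theorem Valid.pole_lt {X : Frame d} (hX : X.Valid) (i : Fin d) (s : Label d) :
    inner ℝ (X.pole i) (X.x s) < 1 := by
  have he := hX.eps_pos i
  have hd := sub_pos.mpr (hX.diag_lt i s)
  rw [pole, inner_add_left, real_inner_smul_left]
  have h1 : |inner ℝ (X.diag i - X.p) (X.x s)| / (1 - inner ℝ (X.diag i) (X.x s)) <
      (X.eps i)⁻¹ := by
    rw [eps, inv_inv]
    have := Finset.single_le_sum (f := fun s =>
      |inner ℝ (X.diag i - X.p) (X.x s)| / (1 - inner ℝ (X.diag i) (X.x s)))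
      (fun t _ => div_nonneg (abs_nonneg _) (sub_pos.mpr (hX.diag_lt i t)).le) (Finset.mem_univ s)
    linarith
  rw [div_lt_iff₀ hd, inv_mul_eq_div, lt_div_iff₀ he] at h1
  nlinarith [le_abs_self (inner ℝ (X.diag i - X.p) (X.x s))]

theorem Valid.ratio_pos {X : Frame d} (hX : X.Valid) (i : Fin d) : 0 < X.ratio i :=
  div_pos (hX.eps_pos i) (add_pos one_pos (hX.eps_pos i))

theorem Valid.ratio_le_one {X : Frame d} (hX : X.Valid) (i : Fin d) : X.ratio i ≤ 1 :=
  (div_le_one (add_pos one_pos (hX.eps_pos i))).2 (by linarith)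

/-- After the polar has been translated by the pole, the next diagonal has its midpoint on the ray
through `p`, at the fraction `ratio` of the way. -/
theorem Valid.shift_pole_diag {X : Frame d} (hX : X.Valid) (i : Fin d) :
    (X.shift (X.pole i)).a i true + (X.shift (X.pole i)).a i false =
      (2 * X.ratio i) • (X.shift (X.pole i)).p := by
  have h1 : (1 + X.eps i) ≠ 0 := (add_pos one_pos (hX.eps_pos i)).ne'
  have hd : X.a i true + X.a i false = (2 : ℝ) • X.diag i := by
    rw [diag, smul_smul]; norm_num
  have h2 : (X.shift (X.pole i)).p = (-(1 + X.eps i)) • (X.diag i - X.p) := by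
    simp only [Frame.shift, Frame.pole]; module
  have h3 : (X.shift (X.pole i)).a i true + (X.shift (X.pole i)).a i false =
      (-(2 * X.eps i)) • (X.diag i - X.p) := by
    simp only [Frame.shift]
    rw [sub_add_sub_comm, hd, Frame.pole]; module
  rw [h2, h3, smul_smul, ratio]
  congr 1
  field_simp

theorem ContinuousFamily.diag {T : Type*} [TopologicalSpace T] {X : T → Frame d}
    (hX : ContinuousFamily X) (i : Fin d) : Continuous fun t => (X t).diag i :=
  ((hX.a i true).add (hX.a i false)).const_smul (1 / 2 : ℝ)

theorem ContinuousFamily.eps {T : Type*} [TopologicalSpace T] {X : T → Frame d}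
    (hX : ContinuousFamily X) (hv : ∀ t, (X t).Valid) (i : Fin d) :
    Continuous fun t => (X t).eps i := by
  refine Continuous.inv₀ (continuous_const.add (continuous_finsetSum _ fun s _ => ?_))
    fun t => (inv_pos.mp ((hv t).eps_pos i)).ne'
  exact (((hX.diag i).sub hX.p).inner (hX.x s)).abs.div
    (continuous_const.sub ((hX.diag i).inner (hX.x s)))
    fun t => (sub_pos.mpr ((hv t).diag_lt i s)).ne'

theorem ContinuousFamily.pole {T : Type*} [TopologicalSpace T] {X : T → Frame d}
    (hX : ContinuousFamily X) (hv : ∀ t, (X t).Valid) (i : Fin d) :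
    Continuous fun t => (X t).pole i :=
  (hX.diag i).add ((hX.eps hv i).smul ((hX.diag i).sub hX.p))

theorem ContinuousFamily.ratio {T : Type*} [TopologicalSpace T] {X : T → Frame d}
    (hX : ContinuousFamily X) (hv : ∀ t, (X t).Valid) (i : Fin d) :
    Continuous fun t => (X t).ratio i :=
  (hX.eps hv i).div (continuous_const.add (hX.eps hv i))
    fun t => (add_pos one_pos ((hv t).eps_pos i)).ne'

theorem Related.diag {g : Space d ≃ᵃ[ℝ] Space d} {X Y : Frame d} (h : Related g X Y)
    (i : Fin d) (v : Space d) : inner ℝ (Y.diag i) (g.linear v) = inner ℝ (X.diag i) v := by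
  simp only [Frame.diag, real_inner_smul_left, inner_add_left, h.a]

theorem Related.eps {g : Space d ≃ᵃ[ℝ] Space d} {X Y : Frame d} (h : Related g X Y)
    (i : Fin d) : Y.eps i = X.eps i := by
  simp only [Frame.eps, inner_sub_left, h.x, h.diag, h.p]

theorem Related.pole {g : Space d ≃ᵃ[ℝ] Space d} {X Y : Frame d} (h : Related g X Y)
    (i : Fin d) (v : Space d) : inner ℝ (Y.pole i) (g.linear v) = inner ℝ (X.pole i) v := by
  simp only [Frame.pole, real_inner_smul_left, inner_add_left, inner_sub_left, h.diag, h.p, h.eps]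

theorem Related.ratio {g : Space d ≃ᵃ[ℝ] Space d} {X Y : Frame d} (h : Related g X Y)
    (i : Fin d) : Y.ratio i = X.ratio i := by
  simp only [Frame.ratio, h.eps]

/-- The first `k` diagonals of the polar cross-polytope have the common midpoint `p`. -/
def Aligned (k : ℕ) (X : Frame d) : Prop :=
  ∀ i : Fin d, (i : ℕ) < k → X.a i true + X.a i false = (2 : ℝ) • X.p

theorem Aligned.shift {k : ℕ} {X : Frame d} (h : X.Aligned k) (o : Space d) :
    (X.shift o).Aligned k := fun i hi => by
  simp only [Frame.shift]
  rw [sub_add_sub_comm, h i hi]; module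

/-- Seen from the pole, the midpoint of the next diagonal lies on the ray through `p`, so pushing
its two end points outwards by the same factor makes the midpoint coincide with `p`. -/
theorem Aligned.next {X : Frame d} (hX : X.Valid) {i : Fin d} (h : X.Aligned i) :
    ((X.shift (X.pole i)).squeeze i (X.ratio i)).Aligned (i + 1) := fun j hj => by
  rcases (Nat.lt_succ_iff.mp hj).eq_or_lt with hji | hji
  · obtain rfl : j = i := Fin.ext hji
    simp only [Frame.squeeze, if_true]
    rw [← smul_add, hX.shift_pole_diag, smul_smul]
    congr 1
    have := (hX.ratio_pos j).ne'
    field_simp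
  · have hne : j ≠ i := fun e => hji.ne (congrArg _ e)
    simp only [Frame.squeeze, if_neg hne, one_smul]
    exact h.shift _ j hji

end Frame

/-! ### The frame of a cube -/

/-- A point of `ℝ^d` is determined by its inner products with the vertex `s` and all but one of
its neighbours on a facet that misses the origin. -/
theorem FacetData.ext_inner_facet {a : Fin d → Bool → Space d} {x : Label d → Space d}
    (H : FacetData a (fun _ _ => 1) x) (i : Fin d) (s : Label d) {u v : Space d}
    (hs : inner ℝ u (x s) = inner ℝ v (x s))
    (hj : ∀ j ≠ i, inner ℝ u (x (neighbour s j)) = inner ℝ v (x (neighbour s j))) : u = v := by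
  have hne := (H.inner_edge_neg s i).ne
  have key : u - v = (inner ℝ (u - v) (x (neighbour s i) - x s) /
      inner ℝ (a i (s i)) (x (neighbour s i) - x s)) • a i (s i) := by
    refine H.ext_inner_edges s fun j => ?_
    rw [real_inner_smul_left]
    by_cases h : j = i
    · subst h; rw [div_mul_cancel₀ _ hne]
    · rw [H.inner_edge_of_ne s (Ne.symm h), mul_zero, inner_sub_right, inner_sub_left,
        inner_sub_left, hs, hj j h]
      ring
  have h0 := congrArg (fun w => inner ℝ w (x s)) key
  simp only [real_inner_smul_left] at h0
  rw [H.eq i (s i) s rfl, mul_one, inner_sub_left, hs, sub_self] at h0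
  rw [← h0, zero_smul, sub_eq_zero] at key
  exact key

/-- The solution of a nondegenerate system of linear equations depends continuously on the
coefficients. -/
theorem continuous_of_inner_eq {T : Type*} [TopologicalSpace T] {w : T → Fin d → Space d}
    (hw : ∀ j, Continuous fun t => w t j)
    (hsep : ∀ t u, (∀ j, inner ℝ u (w t j) = 0) → u = 0) {u : T → Space d} {f : Fin d → ℝ}
    (hu : ∀ t j, inner ℝ (u t) (w t j) = f j) : Continuous u := by
  let M : T → Matrix (Fin d) (Fin d) ℝ := fun t => Matrix.of fun j k => w t j k
  have hM : ∀ t (v : Space d) j, (M t).mulVec v.ofLp j = inner ℝ v (w t j) := fun t v j => by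
    simp [M, Matrix.mulVec, dotProduct, PiLp.inner_apply]
  have hMc : Continuous M := continuous_matrix fun j k =>
    (EuclideanSpace.proj (𝕜 := ℝ) k).continuous.comp (hw j)
  have hdet : ∀ t, (M t).det ≠ 0 := fun t h0 => by
    obtain ⟨v, hv, hMv⟩ := Matrix.exists_mulVec_eq_zero_iff.mpr h0
    refine hv ?_
    have := hsep t (WithLp.toLp 2 v) fun j => by rw [← hM]; exact congrFun hMv j
    simpa using congrArg WithLp.ofLp this
  have hform : u = fun t => WithLp.toLp 2 ((M t).det⁻¹ • (M t).adjugate.mulVec f) := by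
    funext t
    have h1 : (M t).mulVec (u t).ofLp = f := funext fun j => by rw [hM, hu]
    rw [← h1, Matrix.mulVec_mulVec, Matrix.adjugate_mul, Matrix.smul_mulVec, Matrix.one_mulVec,
      smul_smul, inv_mul_cancel₀ (hdet t), one_smul]
  rw [hform]
  exact (PiLp.continuous_toLp 2 _).comp ((hMc.matrix_det.inv₀ hdet).smul
    (hMc.matrix_adjugate.matrix_mulVec continuous_const))

namespace Realization

/-- The midpoint of a main diagonal; it is an interior point of the cube. -/
def center (V : Realization d) : Space d :=
  midpoint ℝ (V.1 fun _ => false) (V.1 fun _ => true)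

theorem exists_polar (V : Realization d) :
    ∃ a, FacetData a (fun _ _ => 1) fun s => V.1 s - V.center := by
  obtain ⟨a, h, H⟩ := exists_facetData V
  have hc : ∀ i b, 0 < h i b - inner ℝ (a i b) V.center := fun i b => by
    rw [center, midpoint_eq_smul_add, real_inner_smul_right, inner_add_right, invOf_eq_inv]
    cases b
    · linarith [H.lt i false (fun _ => true) (by simp), H.le i false fun _ => false]
    · linarith [H.lt i true (fun _ => false) (by simp), H.le i true fun _ => true]
  refine ⟨fun i b => (h i b - inner ℝ (a i b) V.center)⁻¹ • a i b, ?_⟩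
  convert (H.translate (-V.center)).rescale fun i b => inv_pos.mpr (hc i b) using 1
  · funext i b
    rw [inner_neg_right, ← sub_eq_add_neg, inv_mul_cancel₀ (hc i b).ne']
  · funext s
    rw [sub_eq_neg_add]

/-- The frame of a cube with respect to its center. -/
def frame (V : Realization d) : Frame d where
  c := V.center
  x s := V.1 s - V.center
  a := V.exists_polar.choose
  p := 0

theorem frame_valid (V : Realization d) : V.frame.Valid where
  facet := V.exists_polar.choose_spec
  p_lt s := by simp [frame]

theorem realize_frame (V : Realization d) : V.frame.realize V.frame_valid = V :=
  Subtype.ext (funext fun _ => add_sub_cancel _ _)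

theorem continuous_vertex (s : Label d) : Continuous fun V : Realization d => V.1 s :=
  (continuous_apply s).comp continuous_subtype_val

theorem frame_continuous : Frame.ContinuousFamily (frame : Realization d → Frame d) := by
  have hc : Continuous (center : Realization d → Space d) := by
    have : (center : Realization d → Space d) = fun V =>
        (⅟2 : ℝ) • (V.1 (fun _ => false) + V.1 fun _ => true) :=
      funext fun V => midpoint_eq_smul_add _ _ _
    rw [this]
    exact ((continuous_vertex _).add (continuous_vertex _)).const_smul (⅟2 : ℝ)
  have hx : ∀ s, Continuous fun V : Realization d => V.frame.x s := fun s =>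
    (continuous_vertex s).sub hc
  refine ⟨hc, hx, fun i b => ?_, continuous_const⟩
  refine continuous_of_inner_eq (f := fun _ => 1)
    (w := fun V j => V.frame.x (if j = i then fun _ => b else neighbour (fun _ => b) j))
    (fun j => hx _) (fun V u hu => ?_) fun V j => V.frame_valid.facet.eq i b _ ?_
  · refine V.frame_valid.facet.ext_inner_facet i (fun _ => b) ?_ fun j hj => ?_
    · simpa using hu i
    · simpa [hj] using hu j
  · split_ifs with h
    · rfl
    · exact update_of_ne (Ne.symm h) _ _

theorem frame_related {g : Space d ≃ᵃ[ℝ] Space d} {V W : Realization d}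
    (h : ∀ s, W.1 s = g (V.1 s)) : Frame.Related g V.frame W.frame := by
  have hc : W.center = g V.center := by
    have := g.toAffineMap.map_midpoint (V.1 fun _ => false) (V.1 fun _ => true)
    rw [center, center, h, h]; exact this.symm
  have hx : ∀ s, W.frame.x s = g.linear (V.frame.x s) := fun s => by
    simp only [frame]
    rw [hc, h]
    exact (g.toAffineMap.linearMap_vsub _ _).symm
  refine ⟨hc, hx, fun i b v => ?_, fun v => by simp [frame]⟩
  have key : LinearMap.adjoint (g.linear : Space d →ₗ[ℝ] Space d) (W.frame.a i b) =
      V.frame.a i b := by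
    have h1 : ∀ s : Label d, s i = b →
        inner ℝ (LinearMap.adjoint (g.linear : Space d →ₗ[ℝ] Space d) (W.frame.a i b))
          (V.frame.x s) = inner ℝ (V.frame.a i b) (V.frame.x s) := fun s hs => by
      rw [LinearMap.adjoint_inner_left, V.frame_valid.facet.eq i b s hs,
        ← W.frame_valid.facet.eq i b s hs, hx]
      rfl
    exact V.frame_valid.facet.ext_inner_facet i (fun _ => b) (h1 _ rfl) fun j hj =>
      h1 _ (update_of_ne (Ne.symm hj) _ _)
  rw [← key, LinearMap.adjoint_inner_left]
  rfl

/-- The image of a cube under an affine automorphism. -/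
def map (g : Space d ≃ᵃ[ℝ] Space d) (V : Realization d) : Realization d :=
  ⟨fun s => g (V.1 s), by
    obtain ⟨a, h, H⟩ := exists_facetData V
    have key : ∀ (u v : Space d), inner ℝ (LinearMap.adjoint
        (g.symm.linear : Space d →ₗ[ℝ] Space d) u) (g v) =
          inner ℝ u v - inner ℝ u (g.symm 0) := fun u v => by
      rw [LinearMap.adjoint_inner_left, ← inner_sub_right]
      congr 1
      have := g.symm.toAffineMap.linearMap_vsub (g v) 0
      simpa using this
    refine FacetData.faceSets_eq (a := fun i b => LinearMap.adjoint
        (g.symm.linear : Space d →ₗ[ℝ] Space d) (a i b))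
      (h := fun i b => h i b - inner ℝ (a i b) (g.symm 0)) ⟨fun i b s hs => ?_, fun i b s hs => ?_⟩
    · rw [key, H.eq i b s hs]
    · rw [key]; linarith [H.lt i b s hs]⟩

theorem continuous_map (g : Space d ≃ᵃ[ℝ] Space d) : Continuous (map g) :=
  Continuous.subtype_mk (continuous_pi fun s =>
    g.toAffineMap.continuous_of_finiteDimensional.comp (continuous_vertex s)) _

end Realization

/-! ### Parallelepipeds and orthonormalization -/

theorem continuous_gramSchmidt {T : Type*} [TopologicalSpace T] {f : T → Fin d → Space d}
    (hf : ∀ i, Continuous fun t => f t i) (hli : ∀ t, LinearIndependent ℝ (f t)) (n : Fin d) :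
    Continuous fun t => gramSchmidt ℝ (f t) n := by
  induction n using WellFoundedLT.induction with
  | ind n ih =>
    have : (fun t => gramSchmidt ℝ (f t) n) = fun t => f t n - ∑ i ∈ Finset.Iio n,
        (inner ℝ (gramSchmidt ℝ (f t) i) (f t n) / ‖gramSchmidt ℝ (f t) i‖ ^ 2) •
          gramSchmidt ℝ (f t) i :=
      funext fun t => eq_sub_of_add_eq (gramSchmidt_def'' ℝ (f t) n).symm
    rw [this]
    refine (hf n).sub (continuous_finsetSum _ fun i hi => ?_)
    have hi' := ih i (Finset.mem_Iio.mp hi)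
    exact ((hi'.inner (hf n)).div (hi'.norm.pow 2) fun t =>
      pow_ne_zero 2 (norm_ne_zero_iff.mpr (gramSchmidt_ne_zero i (hli t)))).smul hi'

theorem map_gramSchmidt (φ : Space d →ₗᵢ[ℝ] Space d) (f : Fin d → Space d) (n : Fin d) :
    gramSchmidt ℝ (fun i => φ (f i)) n = φ (gramSchmidt ℝ f n) := by
  induction n using WellFoundedLT.induction with
  | ind n ih =>
    have h1 := eq_sub_of_add_eq (gramSchmidt_def'' ℝ (fun i => φ (f i)) n).symm
    have h2 := eq_sub_of_add_eq (gramSchmidt_def'' ℝ f n).symm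
    rw [h1, h2, map_sub, map_sum]
    congr 1
    refine Finset.sum_congr rfl fun i hi => ?_
    rw [ih i (Finset.mem_Iio.mp hi), φ.inner_map_map, φ.norm_map, map_smul]

theorem inner_gramSchmidtNormed_self_pos {f : Fin d → Space d} (hf : LinearIndependent ℝ f)
    (i : Fin d) : 0 < inner ℝ (gramSchmidtNormed ℝ f i) (f i) := by
  have hpos : 0 < ‖gramSchmidt ℝ f i‖ := norm_pos_iff.mpr (gramSchmidt_ne_zero i hf)
  have h : inner ℝ (gramSchmidt ℝ f i) (f i) = ‖gramSchmidt ℝ f i‖ ^ 2 := by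
    conv_lhs => rw [gramSchmidt_def'' ℝ f i]
    rw [inner_add_right, inner_sum, Finset.sum_eq_zero, add_zero, real_inner_self_eq_norm_sq]
    intro j hj
    rw [inner_smul_right, gramSchmidt_orthogonal ℝ f (Finset.mem_Iio.mp hj).ne', mul_zero]
  rw [gramSchmidtNormed, real_inner_smul_left, h]
  exact mul_pos (inv_pos.mpr hpos) (pow_pos hpos 2)

/-- The segment from a basis to half its Gram–Schmidt orthonormalization. -/
def straighten (f : Fin d → Space d) (t : ℝ) (i : Fin d) : Space d :=
  (1 - t) • f i + (t / 2) • gramSchmidtNormed ℝ f i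

/-- With respect to the orthonormal basis at its end, the whole segment consists of triangular
matrices with positive diagonal. -/
theorem linearIndependent_straighten {f : Fin d → Space d} (hf : LinearIndependent ℝ f) {t : ℝ}
    (ht0 : 0 ≤ t) (ht1 : t ≤ 1) : LinearIndependent ℝ (straighten f t) := by
  have ho := gramSchmidtNormed_orthonormal hf
  let M : Matrix (Fin d) (Fin d) ℝ :=
    Matrix.of fun i j => inner ℝ (gramSchmidtNormed ℝ f i) (straighten f t j)
  have hM : M.det ≠ 0 := by
    rw [Matrix.det_of_isUpperTriangular]
    · refine (Finset.prod_pos fun i _ => ?_).ne'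
      simp only [M, Matrix.of_apply, straighten, inner_add_right, inner_smul_right]
      rw [real_inner_self_eq_norm_sq, ho.1]
      have := inner_gramSchmidtNormed_self_pos hf i
      rcases ht0.eq_or_lt with rfl | ht
      · simpa using this
      · nlinarith [mul_nonneg (sub_nonneg.mpr ht1) this.le]
    · intro i j hij
      simp only [M, Matrix.of_apply, straighten, inner_add_right, inner_smul_right]
      have hij : j < i := hij
      rw [ho.2 hij.ne', gramSchmidtNormed, real_inner_smul_left,
        gramSchmidt_inv_triangular ℝ f hij]
      simp
  rw [Fintype.linearIndependent_iff]
  intro g hg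
  have : M.mulVec g = 0 := by
    funext i
    have := congrArg (fun v => inner ℝ (gramSchmidtNormed ℝ f i) v) hg
    simp only [inner_sum, inner_smul_right, inner_zero_right] at this
    simpa [M, Matrix.mulVec, dotProduct, mul_comm] using this
  exact congrFun (Matrix.eq_zero_of_mulVec_eq_zero hM this)

theorem continuous_straighten {T : Type*} [TopologicalSpace T] {f : T → Fin d → Space d}
    (hf : ∀ i, Continuous fun t => f t i) (hli : ∀ t, LinearIndependent ℝ (f t)) {r : T → ℝ}
    (hr : Continuous r) (i : Fin d) : Continuous fun t => straighten (f t) (r t) i := by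
  have hg := continuous_gramSchmidt hf hli i
  have hn : Continuous fun t => gramSchmidtNormed ℝ (f t) i :=
    (hg.norm.inv₀ fun t => norm_ne_zero_iff.mpr (gramSchmidt_ne_zero i (hli t))).smul hg
  exact ((continuous_const.sub hr).smul (hf i)).add ((hr.div_const 2).smul hn)

theorem map_straighten (φ : Space d →ₗᵢ[ℝ] Space d) (f : Fin d → Space d) (t : ℝ) (i : Fin d) :
    straighten (fun i => φ (f i)) t i = φ (straighten f t i) := by
  simp only [straighten, gramSchmidtNormed, map_gramSchmidt, φ.norm_map, map_add, map_smul]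

/-- The sign of a label entry. -/
def sgn (b : Bool) : ℝ := if b then 1 else -1

/-- The affine automorphism which takes the standard cube to the parallelepiped with center `c` and
edge vectors `2 f i`. -/
def boxEquiv (c : Space d) {f : Fin d → Space d} (hf : LinearIndependent ℝ f) :
    Space d ≃ᵃ[ℝ] Space d :=
  (((EuclideanSpace.basisFun (Fin d) ℝ).toBasis.equiv
    (basisOfLinearIndependentOfCardEqFinrank' f hf (by simp)) (Equiv.refl _)).trans
      (LinearEquiv.smulOfNeZero ℝ (Space d) (2 : ℝ) two_ne_zero)).toAffineEquiv.trans
        (AffineEquiv.constVAdd ℝ (Space d) c)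

theorem stdCube_eq_sum (s : Label d) :
    stdCube d s = ∑ i, (sgn (s i) / 2) • EuclideanSpace.single i (1 : ℝ) := by
  ext j
  simp only [WithLp.ofLp_sum, Finset.sum_apply, PiLp.smul_apply, stdCube]
  rw [Finset.sum_eq_single j (fun i _ hij => by simp [hij.symm]) (by simp)]
  cases h : s j <;> simp [sgn, neg_div]

theorem boxEquiv_stdCube (c : Space d) {f : Fin d → Space d} (hf : LinearIndependent ℝ f)
    (s : Label d) : boxEquiv c hf (stdCube d s) = c + ∑ i, sgn (s i) • f i := by
  have hb : ∀ i, ((EuclideanSpace.basisFun (Fin d) ℝ).toBasis.equiv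
      (basisOfLinearIndependentOfCardEqFinrank' f hf (by simp)) (Equiv.refl _))
        (EuclideanSpace.single i (1 : ℝ)) = f i := fun i => by
    have := (EuclideanSpace.basisFun (Fin d) ℝ).toBasis.equiv_apply i
      (basisOfLinearIndependentOfCardEqFinrank' f hf (by simp)) (Equiv.refl _)
    simpa using this
  rw [stdCube_eq_sum]
  simp only [boxEquiv, AffineEquiv.trans_apply, AffineEquiv.constVAdd_apply,
    LinearEquiv.coe_toAffineEquiv, LinearEquiv.trans_apply, map_sum, map_smul, hb, vadd_eq_add,
    LinearEquiv.smulOfNeZero_apply]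
  congr 1
  refine Finset.sum_congr rfl fun i _ => ?_
  rw [smul_smul]
  congr 1
  ring

/-- The parallelepiped with center `c` and edge vectors `2 f i`. -/
def box (c : Space d) {f : Fin d → Space d} (hf : LinearIndependent ℝ f) : Realization d :=
  (Realization.std d).map (boxEquiv c hf)

theorem box_apply (c : Space d) {f : Fin d → Space d} (hf : LinearIndependent ℝ f)
    (s : Label d) : (box c hf).1 s = c + ∑ i, sgn (s i) • f i :=
  boxEquiv_stdCube c hf s

theorem box_affineEquivalence_std (c : Space d) {f : Fin d → Space d}
    (hf : LinearIndependent ℝ f) : affineEquivalence d (box c hf) (Realization.std d) :=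
  Setoid.symm' _ ⟨boxEquiv c hf, fun _ => rfl⟩

theorem box_congruence_std (c : Space d) {f : Fin d → Space d} (hf : LinearIndependent ℝ f)
    (ho : Orthonormal ℝ fun i => (2 : ℝ) • f i) :
    congruence d (box c hf) (Realization.std d) := by
  let B := (OrthonormalBasis.mk ho (by
    rw [ho.linearIndependent.span_eq_top_of_card_eq_finrank' (by simp)]))
  refine Setoid.symm' _ ⟨B.repr.symm.toAffineIsometryEquiv.trans
    (AffineIsometryEquiv.constVAdd ℝ (Space d) c), fun s => ?_⟩
  have hB : ∀ i, B.repr.symm (EuclideanSpace.single i (1 : ℝ)) = (2 : ℝ) • f i := fun i => by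
    simp [B]
  rw [box_apply]
  simp only [Realization.std, stdCube_eq_sum]
  simp only [AffineIsometryEquiv.coe_trans, comp_apply,
    LinearIsometryEquiv.coe_toAffineIsometryEquiv, map_sum, map_smul, hB,
    AffineIsometryEquiv.coe_constVAdd, vadd_eq_add]
  congr 1
  refine Finset.sum_congr rfl fun i _ => ?_
  rw [smul_smul]
  congr 1
  ring

namespace Frame

/-- Half of the `i`-th edge vector at the vertex with label `(1, …, 1)`. -/
def halfEdge (X : Frame d) (i : Fin d) : Space d :=
  (1 / 2 : ℝ) • (X.x (fun _ => true) - X.x (neighbour (fun _ => true) i))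

variable {X : Frame d}

theorem Valid.inner_halfEdge_of_ne (hX : X.Valid) {i j : Fin d} (hij : i ≠ j) :
    inner ℝ (X.a i true) (X.halfEdge j) = 0 := by
  have := hX.facet.inner_edge_of_ne (fun _ => true) hij
  rw [inner_sub_right] at this
  rw [halfEdge, inner_smul_right, inner_sub_right]
  linarith

theorem Valid.linearIndependent_halfEdge (hX : X.Valid) : LinearIndependent ℝ X.halfEdge := by
  refine linearIndependent_of_biorthogonal (a := fun i => X.a i true)
    (fun i j hij => hX.inner_halfEdge_of_ne hij) fun i => ?_
  have := hX.facet.inner_edge_neg (fun _ => true) i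
  rw [inner_sub_right] at this
  rw [halfEdge, inner_smul_right, inner_sub_right]
  linarith

/-- If the polar cross-polytope is centrally symmetric then the cube is a parallelepiped. -/
theorem Valid.realize_eq_box (hX : X.Valid) (h : ∀ i, X.a i true + X.a i false = 0) :
    X.realize hX = box X.c hX.linearIndependent_halfEdge := by
  have hneg : ∀ i v, inner ℝ (X.a i false) v = -inner ℝ (X.a i true) v := fun i v => by
    rw [eq_neg_iff_add_eq_zero, ← inner_add_left, add_comm, h, inner_zero_left]
  have hsgn : ∀ i s, inner ℝ (X.a i true) (X.x s) = sgn (s i) := fun i s => by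
    cases hs : s i
    · have := hX.facet.eq i false s hs
      rw [hneg] at this
      simp only [sgn]; rw [if_neg (by simp)]; linarith
    · rw [hX.facet.eq i true s hs]; rfl
  have hself : ∀ i, inner ℝ (X.a i true) (X.halfEdge i) = 1 := fun i => by
    rw [halfEdge, inner_smul_right, inner_sub_right, hsgn, hsgn]
    simp [sgn]; norm_num
  refine Subtype.ext (funext fun s => ?_)
  rw [box_apply]
  refine congrArg (X.c + ·) ?_
  rw [eq_sum_of_biorthogonal (a := fun i => X.a i true) (e := X.halfEdge)
    (fun i j hij => hX.inner_halfEdge_of_ne hij) (fun i => by rw [hself]; exact one_ne_zero) (X.x s)]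
  simp only [hself, hsgn, div_one]

end Frame

/-! ### Deformations in stages -/

/-- `G` commutes with the affine automorphisms in `𝒢`. -/
def Equivariant (𝒢 : Set (Space d ≃ᵃ[ℝ] Space d)) (G : Realization d → Realization d) : Prop :=
  ∀ g ∈ 𝒢, ∀ Q Q' : Realization d, (∀ s, Q'.1 s = g (Q.1 s)) → ∀ s, (G Q').1 s = g ((G Q).1 s)

/-- Each cube arises from the other by a projective transformation. -/
def MutuallyProjective (V W : Realization d) : Prop :=
  IsProjectiveStep V W ∧ IsProjectiveStep W V

theorem IsNormalStep.symm {V W : Realization d} (h : IsNormalStep V W) : IsNormalStep W V :=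
  ⟨h.1.symm, fun u hu s => (h.2 u (h.1 ▸ hu) s).symm⟩

theorem mutuallyProjective_of_affineEquiv {V W : Realization d} (g : Space d ≃ᵃ[ℝ] Space d)
    (hg : ∀ s, W.1 s = g (V.1 s)) : MutuallyProjective V W :=
  ⟨isProjectiveStep_of_affineEquiv g hg,
    isProjectiveStep_of_affineEquiv g.symm fun s => by rw [hg, AffineEquiv.symm_apply_apply]⟩

theorem MutuallyProjective.refl (V : Realization d) : MutuallyProjective V V :=
  mutuallyProjective_of_affineEquiv (AffineEquiv.refl ℝ _) fun _ => rfl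

/-- A deformation of all cubes, commuting with `𝒢`, in `N` stages of unit length, each of which
consists of projective transformations or of normal transformations only. -/
structure IsStaged (𝒢 : Set (Space d ≃ᵃ[ℝ] Space d)) (N : ℕ)
    (F : Realization d → ℝ → Realization d) : Prop where
  continuous : Continuous fun q : Realization d × ℝ => F q.1 q.2
  zero : ∀ Q, F Q 0 = Q
  stage : ∀ k : ℕ, k < N →
    (∀ Q, ∀ t ∈ Icc (k : ℝ) (k + 1), MutuallyProjective (F Q k) (F Q t)) ∨
    (∀ Q, ∀ t ∈ Icc (k : ℝ) (k + 1), IsNormalStep (F Q k) (F Q t))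
  equivariant : ∀ t, Equivariant 𝒢 fun Q => F Q t

namespace IsStaged

variable {𝒢 : Set (Space d ≃ᵃ[ℝ] Space d)} {N : ℕ} {F : Realization d → ℝ → Realization d}

theorem mono (hF : IsStaged 𝒢 N F) {𝒢' : Set (Space d ≃ᵃ[ℝ] Space d)} (h : 𝒢' ⊆ 𝒢) :
    IsStaged 𝒢' N F :=
  ⟨hF.continuous, hF.zero, hF.stage, fun t g hg => hF.equivariant t g (h hg)⟩

theorem id : IsStaged 𝒢 0 fun (Q : Realization d) _ => Q :=
  ⟨continuous_fst, fun _ => rfl, fun _ hk => absurd hk (Nat.not_lt_zero _),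
    fun _ _ _ _ _ h => h⟩

/-- Append one more stage, whose time parameter runs through the unit interval. -/
theorem extend (hF : IsStaged 𝒢 N F) {H : Realization d → I → Realization d}
    (hH : Continuous fun q : Realization d × I => H q.1 q.2) (h0 : ∀ Q, H Q 0 = F Q N)
    (hk : (∀ Q τ, MutuallyProjective (F Q N) (H Q τ)) ∨ ∀ Q τ, IsNormalStep (F Q N) (H Q τ))
    (hg : ∀ τ, Equivariant 𝒢 fun Q => H Q τ) :
    ∃ F', IsStaged 𝒢 (N + 1) F' ∧ ∀ Q, F' Q (N + 1 : ℕ) = H Q 1 := by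
  classical
  set F' : Realization d → ℝ → Realization d := fun Q t =>
    if t ≤ N then F Q t else H Q (projIcc 0 1 zero_le_one (t - N)) with hF'
  have hle : ∀ Q t, t ≤ (N : ℝ) → F' Q t = F Q t := fun Q t ht => if_pos ht
  have hge : ∀ Q t, (N : ℝ) ≤ t → F' Q t = H Q (projIcc 0 1 zero_le_one (t - N)) := by
    intro Q t ht
    rcases ht.eq_or_lt with rfl | ht
    · rw [hle _ _ le_rfl, sub_self, projIcc_left, ← h0]; rfl
    · exact if_neg ht.not_ge
  refine ⟨F', ⟨?_, fun Q => ?_, fun k hkN => ?_, fun t => ?_⟩, fun Q => ?_⟩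
  · refine Continuous.if_le hF.continuous (hH.comp (continuous_fst.prodMk
        ((continuous_projIcc (h := zero_le_one)).comp (continuous_snd.sub continuous_const))))
      continuous_snd
      continuous_const fun q hq => ?_
    rw [← hge _ _ hq.ge, hle _ _ hq.le]
  · rw [hle _ _ (Nat.cast_nonneg N), hF.zero]
  · rcases (Nat.lt_succ_iff.mp hkN).eq_or_lt with rfl | hlt
    · refine hk.imp (fun h Q t ht => ?_) fun h Q t ht => ?_ <;>
      · rw [hle Q _ le_rfl, hge Q t ht.1]
        exact h _ _
    · have hk1 : (k : ℝ) + 1 ≤ N := by exact_mod_cast hlt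
      refine (hF.stage k hlt).imp (fun h Q t ht => ?_) fun h Q t ht => ?_ <;>
      · rw [hle Q k (by linarith), hle Q t (ht.2.trans hk1)]
        exact h Q t ht
  · rcases le_total t N with ht | ht
    · simp only [fun Q => hle Q t ht]; exact hF.equivariant t
    · simp only [fun Q => hge Q t ht]; exact hg _
  · rw [hge _ _ (by push_cast; linarith)]
    congr 1
    refine projIcc_of_right_le _ ?_
    push_cast; linarith

/-- Append constant stages. -/
theorem pad (hF : IsStaged 𝒢 N F) {M : ℕ} (hNM : N ≤ M) :
    ∃ F', IsStaged 𝒢 M F' ∧ ∀ Q, F' Q M = F Q N := by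
  induction M, hNM using Nat.le_induction with
  | base => exact ⟨F, hF, fun _ => rfl⟩
  | succ M _ ih =>
    obtain ⟨F₁, h₁, e₁⟩ := ih
    obtain ⟨F₂, h₂, e₂⟩ := h₁.extend (H := fun Q _ => F₁ Q M)
      ((h₁.continuous.comp (continuous_id.prodMk continuous_const)).comp continuous_fst)
      (fun _ => rfl) (Or.inl fun Q _ => MutuallyProjective.refl _) fun _ => h₁.equivariant M
    exact ⟨F₂, h₂, fun Q => (e₂ Q).trans (e₁ Q)⟩

end IsStaged

/-- A continuous and affinely equivariant choice of valid frames, one for each cube. -/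
structure IsFrameFamily (X : Realization d → Frame d) : Prop where
  valid : ∀ Q, (X Q).Valid
  continuous : Frame.ContinuousFamily X
  related : ∀ (g : Space d ≃ᵃ[ℝ] Space d) (Q Q' : Realization d), (∀ s, Q'.1 s = g (Q.1 s)) →
    Frame.Related g (X Q) (X Q')

/-- The cubes recorded by the frames `X` are the end of an affinely equivariant deformation of all
cubes in `N` stages. -/
def Reached (N : ℕ) (X : Realization d → Frame d) : Prop :=
  ∃ hX : IsFrameFamily X, ∃ F, IsStaged univ N F ∧ ∀ Q, F Q N = (X Q).realize (hX.valid Q)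

theorem reached_frame : Reached 0 (Realization.frame : Realization d → Frame d) :=
  ⟨⟨Realization.frame_valid, Realization.frame_continuous,
    fun _ _ _ h => Realization.frame_related h⟩, _, IsStaged.id, fun Q => Q.realize_frame.symm⟩

theorem inner_unitInterval_smul_lt {o x : Space d} (h : inner ℝ o x < 1) (τ : I) :
    inner ℝ ((τ : ℝ) • o) x < 1 := by
  rw [real_inner_smul_left]
  rcases τ.2.1.eq_or_lt with h0 | h0
  · rw [← h0, zero_mul]; exact one_pos
  · exact (mul_lt_of_lt_one_right h0 h).trans_le τ.2.2

theorem Reached.shift {N : ℕ} {X : Realization d → Frame d} (h : Reached N X)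
    {o : Realization d → Space d} (ho : Continuous o)
    (hlt : ∀ Q s, inner ℝ (o Q) ((X Q).x s) < 1)
    (hg : ∀ (g : Space d ≃ᵃ[ℝ] Space d) (Q Q' : Realization d), (∀ s, Q'.1 s = g (Q.1 s)) →
      ∀ v, inner ℝ (o Q') (g.linear v) = inner ℝ (o Q) v) :
    Reached (N + 1) fun Q => (X Q).shift (o Q) := by
  obtain ⟨hX, F, hF, hFX⟩ := h
  have hv : ∀ (q : Realization d × I), ((X q.1).shift ((q.2 : ℝ) • o q.1)).Valid := fun q =>
    (hX.valid q.1).shift fun s => inner_unitInterval_smul_lt (hlt q.1 s) q.2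
  have hX' : IsFrameFamily fun Q => (X Q).shift (o Q) :=
    ⟨fun Q => (hX.valid Q).shift (hlt Q), hX.continuous.shift ho hlt,
      fun g Q Q' hQ => (hX.related g Q Q' hQ).shift (hg g Q Q' hQ)⟩
  refine Exists.elim (hF.extend (H := fun Q τ => Frame.realize _ (hv (Q, τ))) ?_ ?_ ?_ ?_)
    fun F' ⟨hF', hF'X⟩ => ?_
  · exact ((hX.continuous.comp continuous_fst).shift
      ((continuous_subtype_val.comp continuous_snd).smul (ho.comp continuous_fst))
      fun q s => inner_unitInterval_smul_lt (hlt q.1 s) q.2).realize hv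
  · intro Q
    rw [hFX]
    refine Subtype.ext (funext fun s => ?_)
    simp [Frame.realize, Frame.shift]
  · refine Or.inl fun Q τ => ?_
    rw [hFX]
    exact ⟨isProjectiveStep_of_perspectivity
        (fun s => inner_unitInterval_smul_lt (hlt Q s) τ) (fun s => rfl) fun s => rfl,
      isProjectiveStep_of_perspectivity_symm
        (fun s => inner_unitInterval_smul_lt (hlt Q s) τ) (fun s => rfl) fun s => rfl⟩
  · intro τ g _ Q Q' hQ s
    refine ((hX.related g Q Q' hQ).shift (o := (τ : ℝ) • o Q) (o' := (τ : ℝ) • o Q')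
      fun v => ?_).vertex s
    rw [real_inner_smul_left, real_inner_smul_left, hg g Q Q' hQ]
  · refine ⟨hX', F', hF', fun Q => ?_⟩
    rw [hF'X]
    simp only [Icc.coe_one, one_smul]

theorem Reached.squeeze {N : ℕ} {X : Realization d → Frame d} (h : Reached N X) (j : Fin d)
    {l : Realization d → ℝ} (hl : Continuous l) (hl0 : ∀ Q, 0 < l Q) (hl1 : ∀ Q, l Q ≤ 1)
    (hj : ∀ Q, (X Q).a j true + (X Q).a j false = (2 * l Q) • (X Q).p)
    (hg : ∀ (g : Space d ≃ᵃ[ℝ] Space d) (Q Q' : Realization d), (∀ s, Q'.1 s = g (Q.1 s)) →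
      l Q' = l Q) :
    Reached (N + 1) fun Q => (X Q).squeeze j (l Q) := by
  obtain ⟨hX, F, hF, hFX⟩ := h
  set m : Realization d × I → ℝ := fun q => 1 - q.2 * (1 - l q.1) with hm
  have hlm : ∀ q, l q.1 ≤ m q := fun q => by
    have := mul_le_of_le_one_left (sub_nonneg.mpr (hl1 q.1)) q.2.2.2
    simp only [hm]; linarith
  have hm1 : ∀ q, m q ≤ 1 := fun q => by
    have := mul_nonneg q.2.2.1 (sub_nonneg.mpr (hl1 q.1))
    simp only [hm]; linarith
  have hmc : Continuous m := continuous_const.sub ((continuous_subtype_val.comp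
    continuous_snd).mul (continuous_const.sub (hl.comp continuous_fst)))
  have hv : ∀ q : Realization d × I, ((X q.1).squeeze j (m q)).Valid := fun q =>
    (hX.valid q.1).squeeze (hl0 q.1) (hlm q) (hm1 q) (hj q.1)
  have hX' : IsFrameFamily fun Q => (X Q).squeeze j (l Q) :=
    ⟨fun Q => (hX.valid Q).squeeze (hl0 Q) le_rfl (hl1 Q) (hj Q),
      hX.continuous.squeeze hX.valid j hl hl0, fun g Q Q' hQ => by
        rw [hg g Q Q' hQ]; exact (hX.related g Q Q' hQ).squeeze j _⟩
  refine Exists.elim (hF.extend (H := fun Q τ => Frame.realize _ (hv (Q, τ))) ?_ ?_ ?_ ?_)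
    fun F' ⟨hF', hF'X⟩ => ?_
  · exact ((hX.continuous.comp continuous_fst).squeeze (fun q => hX.valid q.1) j hmc
      fun q => (hl0 q.1).trans_le (hlm q)).realize hv
  · intro Q
    rw [hFX]
    refine Subtype.ext (funext fun s => ?_)
    simp [Frame.realize, Frame.squeeze, hm]
  · refine Or.inr fun Q τ => ?_
    rw [hFX]
    exact ((hX.valid Q).facet.translate _).isNormalStep
      (((hX.valid Q).facetData_squeeze (hl0 Q) (hlm (Q, τ)) (hm1 (Q, τ)) (hj Q)).1.translate _)
  · intro τ g _ Q Q' hQ s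
    have : m (Q', τ) = m (Q, τ) := by simp only [hm, hg g Q Q' hQ]
    simp only [this]
    exact ((hX.related g Q Q' hQ).squeeze j _).vertex s
  · refine ⟨hX', F', hF', fun Q => ?_⟩
    rw [hF'X]
    simp only [hm, Icc.coe_one, one_mul, sub_sub_cancel]

/-- One projective and one normal stage for each direction give all diagonals of the polar
cross-polytope a common midpoint. -/
theorem exists_reached_aligned (k : ℕ) (hk : k ≤ d) :
    ∃ X : Realization d → Frame d, Reached (2 * k) X ∧ ∀ Q, (X Q).Aligned k := by
  induction k with
  | zero => exact ⟨_, reached_frame, fun Q i hi => absurd hi (Nat.not_lt_zero _)⟩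
  | succ k ih =>
    obtain ⟨X, hX, hal⟩ := ih (Nat.le_of_succ_le hk)
    obtain ⟨hfam, -⟩ := id hX
    let i : Fin d := ⟨k, hk⟩
    refine ⟨fun Q => ((X Q).shift ((X Q).pole i)).squeeze i ((X Q).ratio i), ?_, fun Q =>
      Frame.Aligned.next (i := i) (hfam.valid Q) (hal Q)⟩
    have h1 := hX.shift (hfam.continuous.pole hfam.valid i)
      (fun Q s => (hfam.valid Q).pole_lt i s)
      fun g Q Q' hQ => (hfam.related g Q Q' hQ).pole i
    exact h1.squeeze i (hfam.continuous.ratio hfam.valid i) (fun Q => (hfam.valid Q).ratio_pos i)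
      (fun Q => (hfam.valid Q).ratio_le_one i) (fun Q => (hfam.valid Q).shift_pole_diag i)
      fun g Q Q' hQ => (hfam.related g Q Q' hQ).ratio i

/-- Moving the origin of the polar to the common midpoint of the diagonals makes the cube a
parallelepiped. -/
theorem exists_reached_symmetric :
    ∃ X : Realization d → Frame d, Reached (2 * d + 1) X ∧
      ∀ Q i, (X Q).a i true + (X Q).a i false = 0 := by
  obtain ⟨X, hX, hal⟩ := exists_reached_aligned d le_rfl
  obtain ⟨hfam, -⟩ := id hX
  refine ⟨_, hX.shift hfam.continuous.p (fun Q s => (hfam.valid Q).p_lt s)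
    fun g Q Q' hQ => (hfam.related g Q Q' hQ).p, fun Q i => ?_⟩
  rw [(hal Q).shift _ i i.2]
  simp [Frame.shift]

/-- All stages but the orthonormalization commute with every affine automorphism. -/
theorem exists_affine_deformation :
    ∃ F : Realization d → ℝ → Realization d, IsStaged univ (2 * d + 1) F ∧
      ∀ Q, affineEquivalence d (F Q (2 * d + 1 : ℕ)) (Realization.std d) := by
  obtain ⟨X, ⟨hfam, F, hF, hFX⟩, hsymm⟩ := exists_reached_symmetric (d := d)
  refine ⟨F, hF, fun Q => ?_⟩
  rw [hFX, (hfam.valid Q).realize_eq_box (hsymm Q)]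
  exact box_affineEquivalence_std _ _

/-- The isometries among the affine automorphisms. -/
def isometries (d : ℕ) : Set (Space d ≃ᵃ[ℝ] Space d) :=
  range fun g : Space d ≃ᵃⁱ[ℝ] Space d => g.toAffineEquiv

/-- One last affine stage, by Gram–Schmidt, takes the parallelepiped to a congruent copy of the
standard cube; it commutes with isometries only. -/
theorem exists_isometric_deformation :
    ∃ F : Realization d → ℝ → Realization d, IsStaged (isometries d) (2 * d + 2) F ∧
      ∀ Q, congruence d (F Q (2 * d + 2 : ℕ)) (Realization.std d) := by
  obtain ⟨X, ⟨hfam, F, hF, hFX⟩, hsymm⟩ := exists_reached_symmetric (d := d)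
  have hli : ∀ Q, LinearIndependent ℝ (X Q).halfEdge := fun Q =>
    (hfam.valid Q).linearIndependent_halfEdge
  have hbox : ∀ Q, F Q (2 * d + 1 : ℕ) = box (X Q).c (hli Q) := fun Q => by
    rw [hFX, (hfam.valid Q).realize_eq_box (hsymm Q)]
  have hli' : ∀ q : Realization d × I, LinearIndependent ℝ (straighten (X q.1).halfEdge q.2) :=
    fun q => linearIndependent_straighten (hli q.1) q.2.2.1 q.2.2.2
  have hhalf : ∀ i, Continuous fun Q => (X Q).halfEdge i := fun i =>
    ((hfam.continuous.x _).sub (hfam.continuous.x _)).const_smul (1 / 2 : ℝ)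
  refine Exists.elim ((hF.mono (subset_univ (isometries d))).extend
    (H := fun Q τ => box (X Q).c (hli' (Q, τ))) ?_ ?_ ?_ ?_)
    fun F' ⟨hF', hF'X⟩ => ?_
  · refine Continuous.subtype_mk (continuous_pi fun s => ?_) _
    change Continuous fun q : Realization d × I => (box (X q.1).c (hli' q)).1 s
    simp only [box_apply]
    refine (hfam.continuous.c.comp continuous_fst).add (continuous_finsetSum _ fun i _ => ?_)
    exact (continuous_straighten (f := fun q : Realization d × I => (X q.1).halfEdge)
      (fun i => (hhalf i).comp continuous_fst) (fun q => hli q.1)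
      (continuous_subtype_val.comp continuous_snd) i).const_smul (sgn (s i))
  · intro Q
    rw [hbox]
    refine Subtype.ext (funext fun s => ?_)
    rw [box_apply, box_apply]
    simp [straighten]
  · refine Or.inl fun Q τ => ?_
    rw [hbox]
    obtain ⟨g, hg⟩ := Setoid.trans' _ (box_affineEquivalence_std (X Q).c (hli Q))
      (Setoid.symm' _ (box_affineEquivalence_std (X Q).c (hli' (Q, τ))))
    exact mutuallyProjective_of_affineEquiv g hg
  · rintro τ _ ⟨g, rfl⟩ Q Q' hQ s
    have hrel := hfam.related _ Q Q' hQ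
    have hlin : ∀ v, g.toAffineEquiv.linear v = g.linearIsometryEquiv.toLinearIsometry v :=
      fun v => rfl
    have hhalf' : (X Q').halfEdge =
        fun i => g.linearIsometryEquiv.toLinearIsometry ((X Q).halfEdge i) := by
      funext i
      simp only [Frame.halfEdge, hrel.x, hlin, map_smul, map_sub]
    simp only [box_apply]
    rw [hhalf', hrel.c]
    simp only [map_straighten, ← map_smul, ← map_sum]
    rw [add_comm, add_comm (X Q).c]
    exact (g.map_vadd _ _).symm
  · refine ⟨F', hF', fun Q => ?_⟩
    rw [hF'X]
    refine box_congruence_std _ _ ?_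
    have : (fun i => (2 : ℝ) • straighten (X Q).halfEdge ((1 : I) : ℝ) i) =
        InnerProductSpace.gramSchmidtNormed ℝ (X Q).halfEdge := by
      funext i
      simp [straighten, smul_smul]
    rw [this]
    exact InnerProductSpace.gramSchmidtNormed_orthonormal (hli Q)

/-- If the orbits of `𝒢` are the classes of an equivalence relation, then a `𝒢`-equivariant
deformation into a single class contracts the quotient. -/
theorem contractibleSpace_quotient {r : Setoid (Realization d)}
    {𝒢 : Set (Space d ≃ᵃ[ℝ] Space d)}
    (hr : ∀ V W, r V W ↔ ∃ g ∈ 𝒢, ∀ s, W.1 s = g (V.1 s)) {N : ℕ}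
    {F : Realization d → ℝ → Realization d} (hF : IsStaged 𝒢 N F)
    (hN : ∀ Q, r (F Q N) (Realization.std d)) : ContractibleSpace (Quotient r) := by
  have hopen : IsOpenQuotientMap (Quotient.mk r) := by
    refine ⟨Quotient.mk_surjective, continuous_quotient_mk', fun U hU => ?_⟩
    rw [← isQuotientMap_quotient_mk'.isOpen_preimage]
    -- The saturation of an open set is the union of its translates.
    have : Quotient.mk r ⁻¹' (Quotient.mk r '' U) = ⋃ g ∈ 𝒢, Realization.map g ⁻¹' U := by
      ext V
      simp only [mem_preimage, mem_image, mem_iUnion, exists_prop]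
      constructor
      · rintro ⟨W, hW, hWV⟩
        obtain ⟨g, hg, hs⟩ := (hr V W).1 (Setoid.symm' r (Quotient.exact hWV))
        exact ⟨g, hg, by rwa [show Realization.map g V = W from
          Subtype.ext (funext fun s => (hs s).symm)]⟩
      · rintro ⟨g, hg, hV⟩
        exact ⟨_, hV, Quotient.sound (Setoid.symm' r ((hr _ _).2 ⟨g, hg, fun _ => rfl⟩))⟩
    change IsOpen (Quotient.mk r ⁻¹' (Quotient.mk r '' U))
    rw [this]
    exact isOpen_biUnion fun g _ => hU.preimage (Realization.continuous_map g)
  have hF_rel : ∀ t V W, r V W → r (F V t) (F W t) := fun t V W hVW => by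
    obtain ⟨g, hg, hs⟩ := (hr V W).1 hVW
    exact (hr _ _).2 ⟨g, hg, hF.equivariant t g hg V W hs⟩
  let K : I × Quotient r → Quotient r := fun q =>
    Quotient.lift (fun V => Quotient.mk r (F V (q.1 * N)))
      (fun V W h => Quotient.sound (hF_rel _ V W h)) q.2
  have hK : Continuous K := by
    rw [← (IsOpenQuotientMap.prodMap (IsOpenQuotientMap.id (X := I)) hopen).continuous_comp_iff]
    exact hopen.continuous.comp (hF.continuous.comp (continuous_snd.prodMk
      ((continuous_subtype_val.comp continuous_fst).mul continuous_const)))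
  rw [contractible_iff_id_nullhomotopic]
  refine ⟨Quotient.mk r (Realization.std d), ⟨⟨⟨K, hK⟩, fun q => ?_, fun q => ?_⟩⟩⟩
  · induction q using Quotient.inductionOn with
    | h V => simp [K, hF.zero]
  · induction q using Quotient.inductionOn with
    | h V => simpa [K] using Quotient.sound (hN V)

/-- Two cubes are connected through the parallelepipeds at the ends of their deformations, which
are affinely equivalent. -/
theorem exists_chain (Q Q' : Realization d) :
    ∃ P : ℕ → Realization d, P 0 = Q ∧ P (4 * d + 3) = Q' ∧
      ∀ k < 4 * d + 3, IsProjectiveStep (P k) (P (k + 1)) ∨ IsNormalStep (P k) (P (k + 1)) := by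
  obtain ⟨F, hF, hstd⟩ := exists_affine_deformation (d := d)
  have hstep : ∀ k < 2 * d + 1,
      (∀ Q, MutuallyProjective (F Q (k : ℕ)) (F Q (k + 1 : ℕ))) ∨
        ∀ Q, IsNormalStep (F Q (k : ℕ)) (F Q (k + 1 : ℕ)) := fun k hk => by
    push_cast
    exact (hF.stage k hk).imp (fun h Q => h Q _ ⟨by linarith, le_rfl⟩)
      fun h Q => h Q _ ⟨by linarith, le_rfl⟩
  refine ⟨fun k => if k ≤ 2 * d + 1 then F Q k else F Q' (4 * d + 3 - k : ℕ), ?_, ?_,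
    fun k hk => ?_⟩
  · simp [hF.zero]
  · simp only
    rw [if_neg (by omega), Nat.sub_self, Nat.cast_zero, hF.zero]
  · rcases lt_trichotomy k (2 * d + 1) with h | h | h
    · simp only
      rw [if_pos h.le, if_pos (by omega)]
      exact (hstep k h).imp (fun h => (h Q).1) fun h => h Q
    · subst h
      simp only
      rw [if_pos le_rfl, if_neg (by omega),
        show 4 * d + 3 - (2 * d + 1 + 1) = 2 * d + 1 by omega]
      obtain ⟨g, hg⟩ := Setoid.trans' _ (hstd Q) (Setoid.symm' _ (hstd Q'))
      exact Or.inl (isProjectiveStep_of_affineEquiv g hg)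
    · simp only
      rw [if_neg (by omega), if_neg (by omega),
        show 4 * d + 3 - k = 4 * d + 3 - (k + 1) + 1 by omega]
      exact (hstep (4 * d + 3 - (k + 1)) (by omega)).imp (fun h => (h Q').2)
        fun h => (h Q').symm

end NormalProjective
end

open NormalProjective in
theorem theorem1p1 (d : ℕ) (hd : 0 < d) :
    -- (a) any two realizations are connected by at most `8 d - 1` steps through realizations
    (∀ Q Q' : Realization d, ∃ m : ℕ, m ≤ 8 * d - 1 ∧ ∃ P : ℕ → Realization d,
      P 0 = Q ∧ P m = Q' ∧
        ∀ k < m, IsProjectiveStep (P k) (P (k + 1)) ∨ IsNormalStep (P k) (P (k + 1))) ∧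
    -- (b) a continuous deformation of all cubes to the standard cube, in `4 d + 2` stages of
    -- projective or normal transformations, compatible with isometries
    (∃ F : Realization d → ℝ → Realization d,
      ContinuousOn (fun p : Realization d × ℝ => F p.1 p.2)
        (Set.univ ×ˢ Set.Icc (0 : ℝ) (4 * d + 2)) ∧
      (∀ Q, F Q 0 = Q) ∧
      (∀ Q, congruence d (F Q (4 * d + 2)) (Realization.std d)) ∧
      (∀ k : ℕ, k < 4 * d + 2 →
        (∀ Q, ∀ t ∈ Set.Icc (k : ℝ) (k + 1), IsProjectiveStep (F Q k) (F Q t)) ∨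
        (∀ Q, ∀ t ∈ Set.Icc (k : ℝ) (k + 1), IsNormalStep (F Q k) (F Q t))) ∧
      (∀ (g : Space d ≃ᵃⁱ[ℝ] Space d) (Q Q' : Realization d), (∀ s, Q'.1 s = g (Q.1 s)) →
        ∀ t ∈ Set.Icc (0 : ℝ) (4 * d + 2), ∀ s, (F Q' t).1 s = g ((F Q t).1 s))) ∧
    -- the realization space is contractible
    ContractibleSpace (CongruenceRealizationSpace d) ∧
    ContractibleSpace (AffineRealizationSpace d) := by
  obtain ⟨F₁, hF₁, hstd₁⟩ := exists_isometric_deformation (d := d)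
  obtain ⟨F, hF, hpad⟩ := hF₁.pad (show 2 * d + 2 ≤ 4 * d + 2 by omega)
  obtain ⟨G, hG, hstd⟩ := exists_affine_deformation (d := d)
  refine ⟨fun Q Q' => ⟨4 * d + 3, by omega, exists_chain Q Q'⟩,
    ⟨F, hF.continuous.continuousOn, hF.zero, fun Q => ?_, fun k hk => ?_,
      fun g Q Q' hQ t _ => hF.equivariant t _ ⟨g, rfl⟩ Q Q' hQ⟩,
    contractibleSpace_quotient (fun V W => ?_) hF₁ hstd₁,
    contractibleSpace_quotient (fun V W => ?_) hG hstd⟩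
  · have := hpad Q
    push_cast at this
    rw [this]
    exact_mod_cast hstd₁ Q
  · exact (hF.stage k hk).imp_left fun h Q t ht => (h Q t ht).1
  · exact ⟨fun ⟨g, hg⟩ => ⟨_, ⟨g, rfl⟩, hg⟩, by rintro ⟨_, ⟨g, rfl⟩, hg⟩; exact ⟨g, hg⟩⟩
  · exact ⟨fun ⟨g, hg⟩ => ⟨g, Set.mem_univ _, hg⟩, fun ⟨g, _, hg⟩ => ⟨g, hg⟩⟩
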